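/- Let $L,\delta>0$. Let $\zeta(z)=\zeta(z|L/2,{\rm i}\delta)$ and $\wp=-\zeta'$ be the Weierstrass functions with half-periods $\omega_1=L/2$, $\omega_2={\rm i}\delta$ (period lattice $\Lambda=L\mathbb Z+2{\rm i}\delta\mathbb Z$), and put $\zeta_j(z)=\zeta(z)-\frac{\zeta(\omega_j)}{\omega_j}z$ for $j=1,2$. For $L$-periodic $f$ let $$(Tf)(x)=\frac1\pi\,\mathrm{p.v.}\!\!\int_{-L/2}^{L/2}\zeta_1(x'-x)f(x')\,dx',\qquad (\tilde Tf)(x)=\frac1\pi\int_{-L/2}^{L/2}\zeta_1(x'-x+{\rm i}\delta)f(x')\,dx'.$$ Let $N\ge 0$ be an integer and let $a_j,b_j\in\mathbb C$ $(j=1,\dots,N)$ satisfy $$|\mathrm{Im}\,a_j-2\delta n|>\delta/2,\qquad |\mathrm{Im}\,b_j-2\delta n|>\delta/2\qquad\text{for all } n\in\mathbb Z .$$ Let $I\subseteq\mathbb R$ be an open interval containing $0$ (possibly $I=\mathbb R$), and let $z_j,w_j:I\to\mathbb C$ be twice differentiable functions such that for all $t\in I$ and all $j$: $z_j-z_k\notin\Lambda$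 and $w_j-w_k\notin\Lambda$ for $k\ne j$; $\mathrm{Im}(z_j\pm{\rm i}\delta/2)\ne 2\delta n$ and $\mathrm{Im}(w_j\pm{\rm i}\delta/2)\neq 2\delta n$ for all integers $n$; and the elliptic Calogero--Moser equations $$\ddot z_j=-4\sum_{k\ne j}\wp'(z_j-z_k),\qquad \ddot w_j=-4\sum_{k\neq j}\wp'(w_j-w_k)$$ hold, with initial conditions $z_j(0)=a_j$, $w_j(0)=b_j$, $$\dot z_j(0)=2{\rm i}\sum_{k\ne j}\zeta_2(a_j-a_k)-2{\rm i}\sum_{k=1}^N\zeta_2(a_j-b_k+{\rm i}\delta),\qquad \dot w_j(0)=-2{\rm i}\sum_{k\ne j}\zeta_2(b_j-b_k)+2{\rm i}\sum_{k=1}^N\zeta_2(b_j-a_k+{\rm i}\delta).$$ Then the functions $$u(x,t)={\rm i}\sum_{j=1}^N\zeta_2\big(x-z_j(t)-\tfrac{{\rm i}\delta}2\big)-{\rm i}\sum_{j=1}^N\zeta_2\big(x-w_j(t)+\tfrac{{\rm i}\delta}2\big),$$ $$v(x,t)=-{\rm i}\sum_{j=1}^N\zeta_2\big(x-z_j(t)+\tfrac{{\rm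 i}\delta}2\big)+{\rm i}\sum_{j=1}^N\zeta_2\big(x-w_j(t)-\tfrac{{\rm i}\delta}2\big)$$ are $L$-periodic in $x$ and are a classical solution (jointly $C^2$, with all integrals in $Tu_{xx},Tv_{xx},\tilde Tu_{xx},\tilde Tv_{xx}$ existing) of the periodic non-chiral intermediate long-wave equation $$u_t+2uu_x+Tu_{xx}+\tilde Tv_{xx}=0,\qquad v_t-2vv_x-Tv_{xx}-\tilde Tu_{xx}=0\qquad (x\in\mathbb R,\ t\in I).$$ -/

import Mathlib

open MeasureTheory Filter Topology

noncomputable section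

namespace NcILW

/-- The periods `L` and `2iδ`, that is, the half-periods `ω₁ = L/2` and `ω₂ = iδ`. -/
def periods (L δ : ℝ) (hL : 0 < L) (hδ : 0 < δ) : PeriodPair where
  ω₁ := (L : ℂ)
  ω₂ := 2 * Complex.I * (δ : ℂ)
  indep := by
    rw [LinearIndependent.pair_iff]
    intro s t h
    have h1 := congrArg Complex.re h
    have h2 := congrArg Complex.im h
    simp at h1 h2
    exact ⟨h1.resolve_right hL.ne', h2.resolve_right hδ.ne'⟩

/-- The Weierstrass `ζ`-function of the lattice `Λ` of `P`,
`ζ(z) = 1/z + ∑_{l ∈ Λ, l ≠ 0} (1/(z - l) + 1/l + z/l²)`;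
with `1/0 = 0` the term `l = 0` of the sum below is `1/z`. -/
def weierstrassZeta (P : PeriodPair) (z : ℂ) : ℂ :=
  ∑' l : P.lattice, (1 / (z - (l : ℂ)) + 1 / (l : ℂ) + z / (l : ℂ) ^ 2)

/-- `ζ₁(z) = ζ(z) - (η₁/ω₁) z`, where `ω₁` is the first half-period and `η₁ = ζ(ω₁)`.
(The fields of `P` are the full periods.) -/
def zeta₁ (P : PeriodPair) (z : ℂ) : ℂ :=
  weierstrassZeta P z - weierstrassZeta P (P.ω₁ / 2) / (P.ω₁ / 2) * z

/-- `ζ₂(z) = ζ(z) - (η₂/ω₂) z`, where `ω₂` is the second half-period and `η₂ = ζ(ω₂)`. -/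
def zeta₂ (P : PeriodPair) (z : ℂ) : ℂ :=
  weierstrassZeta P z - weierstrassZeta P (P.ω₂ / 2) / (P.ω₂ / 2) * z

/-- The part of the period interval `[-L/2, L/2]` at distance more than `ε` from the
singularities `x + Lℤ` of the kernel `x' ↦ ζ₁(x' - x)`. -/
def truncatedInterval (L x ε : ℝ) : Set ℝ :=
  {x' | x' ∈ Set.Icc (-(L / 2)) (L / 2) ∧ ∀ n : ℤ, ε < |x' - x - n * L|}

/-- `(T f)(x)` exists and equals `y`, where
`(T f)(x) = (1/π) p.v. ∫_{-L/2}^{L/2} ζ₁(x' - x | L/2, iδ) f(x') dx'`. -/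
def HasT (L δ : ℝ) (hL : 0 < L) (hδ : 0 < δ) (f : ℝ → ℂ) (x : ℝ) (y : ℂ) : Prop :=
  (∀ ε : ℝ, 0 < ε →
    IntegrableOn (fun x' : ℝ => zeta₁ (periods L δ hL hδ) ((x' : ℂ) - (x : ℂ)) * f x')
      (truncatedInterval L x ε)) ∧
  Tendsto
    (fun ε : ℝ => 1 / (Real.pi : ℂ) *
      ∫ x' in truncatedInterval L x ε,
        zeta₁ (periods L δ hL hδ) ((x' : ℂ) - (x : ℂ)) * f x')
    (𝓝[>] 0) (𝓝 y)

/-- `(T̃ f)(x)` exists and equals `y`, where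
`(T̃ f)(x) = (1/π) ∫_{-L/2}^{L/2} ζ₁(x' - x + iδ | L/2, iδ) f(x') dx'`. -/
def HasTtilde (L δ : ℝ) (hL : 0 < L) (hδ : 0 < δ) (f : ℝ → ℂ) (x : ℝ) (y : ℂ) : Prop :=
  IntervalIntegrable
    (fun x' : ℝ =>
      zeta₁ (periods L δ hL hδ) ((x' : ℂ) - (x : ℂ) + Complex.I * (δ : ℂ)) * f x')
    volume (-(L / 2)) (L / 2) ∧
  1 / (Real.pi : ℂ) * (∫ x' in (-(L / 2))..(L / 2),
    zeta₁ (periods L δ hL hδ) ((x' : ℂ) - (x : ℂ) + Complex.I * (δ : ℂ)) * f x') = y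

/-- `(u, v)` is a (classical, complex-valued, `L`-periodic) solution of the periodic non-chiral
intermediate long-wave equation
`u_t + 2 u u_x + T u_xx + T̃ v_xx = 0`, `v_t - 2 v v_x - T v_xx - T̃ u_xx = 0`
for `x ∈ ℝ` and `t` in the open set `I`. -/
structure IsPeriodicSolution (L δ : ℝ) (hL : 0 < L) (hδ : 0 < δ) (I : Set ℝ)
    (u v : ℝ → ℝ → ℂ) : Prop where
  contDiffOn_u : ContDiffOn ℝ 2 (fun p : ℝ × ℝ => u p.1 p.2) (Set.univ ×ˢ I)
  contDiffOn_v : ContDiffOn ℝ 2 (fun p : ℝ × ℝ => v p.1 p.2) (Set.univ ×ˢ I)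
  periodic_u : ∀ t ∈ I, ∀ x : ℝ, u (x + L) t = u x t
  periodic_v : ∀ t ∈ I, ∀ x : ℝ, v (x + L) t = v x t
  equation : ∀ t ∈ I, ∀ x : ℝ, ∃ Tu Tv Ttu Ttv : ℂ,
    HasT L δ hL hδ (iteratedDeriv 2 (fun y : ℝ => u y t)) x Tu ∧
    HasT L δ hL hδ (iteratedDeriv 2 (fun y : ℝ => v y t)) x Tv ∧
    HasTtilde L δ hL hδ (iteratedDeriv 2 (fun y : ℝ => u y t)) x Ttu ∧
    HasTtilde L δ hL hδ (iteratedDeriv 2 (fun y : ℝ => v y t)) x Ttv ∧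
    deriv (fun s : ℝ => u x s) t + 2 * u x t * deriv (fun y : ℝ => u y t) x + Tu + Ttv = 0 ∧
    deriv (fun s : ℝ => v x s) t - 2 * v x t * deriv (fun y : ℝ => v y t) x - Tv - Ttu = 0

/-- The elliptic Calogero–Moser equations
`z̈_j = -4 ∑_{k ≠ j} ℘'(z_j - z_k | L/2, iδ)` for `t` in the open set `I`, for `N` particles
which do not collide on the torus `ℂ / (Lℤ + 2iδℤ)` and whose positions satisfy
`Im (z_j ± iδ/2) ≠ 2δn` for all integers `n`. -/
structure IsCalogeroMoser (L δ : ℝ) (hL : 0 < L) (hδ : 0 < δ) (I : Set ℝ) {N : ℕ}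
    (z : Fin N → ℝ → ℂ) : Prop where
  differentiableAt : ∀ t ∈ I, ∀ j, DifferentiableAt ℝ (z j) t
  noncollision : ∀ t ∈ I, ∀ j k, j ≠ k → z j t - z k t ∉ (periods L δ hL hδ).lattice
  equation : ∀ t ∈ I, ∀ j,
    HasDerivAt (deriv (z j))
      (-4 * ∑ k ∈ Finset.univ.erase j, (periods L δ hL hδ).derivWeierstrassP (z j t - z k t)) t
  im_ne : ∀ t ∈ I, ∀ j, ∀ n : ℤ,
    (z j t + Complex.I * (δ : ℂ) / 2).im ≠ 2 * δ * n ∧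
    (z j t - Complex.I * (δ : ℂ) / 2).im ≠ 2 * δ * n

/-- `u = i ∑_j ζ₂(x - z_j(t) - iδ/2 | L/2, iδ) - i ∑_j ζ₂(x - w_j(t) + iδ/2 | L/2, iδ)`. -/
def solitonU (L δ : ℝ) (hL : 0 < L) (hδ : 0 < δ) {N : ℕ} (z w : Fin N → ℝ → ℂ)
    (x t : ℝ) : ℂ :=
  Complex.I * ∑ j, zeta₂ (periods L δ hL hδ) ((x : ℂ) - z j t - Complex.I * (δ : ℂ) / 2)
  - Complex.I * ∑ j, zeta₂ (periods L δ hL hδ) ((x : ℂ) - w j t + Complex.I * (δ : ℂ) / 2)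

/-- `v = -i ∑_j ζ₂(x - z_j(t) + iδ/2 | L/2, iδ) + i ∑_j ζ₂(x - w_j(t) - iδ/2 | L/2, iδ)`. -/
def solitonV (L δ : ℝ) (hL : 0 < L) (hδ : 0 < δ) {N : ℕ} (z w : Fin N → ℝ → ℂ)
    (x t : ℝ) : ℂ :=
  -Complex.I * ∑ j, zeta₂ (periods L δ hL hδ) ((x : ℂ) - z j t + Complex.I * (δ : ℂ) / 2)
  + Complex.I * ∑ j, zeta₂ (periods L δ hL hδ) ((x : ℂ) - w j t - Complex.I * (δ : ℂ) / 2)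

end NcILW

end

/-!
Up to the period `2iδ`, both `u` and `v` are fields `i ∑ r_m ζ₂(x - p_m)` of charges `r_m = ±1`
with `∑ r_m = 0`, placed at the shifted poles `z_j + iδ/2`, `w_j - iδ/2`; for `v` the charges are
reversed and the poles moved by `-iδ`.

*Nonlocal terms.* The integral of `ζ₁` over a period of the line `Im z = y` is locally constant in
`y`, and jumps as the line crosses `Λ`. The differentiated addition formula turns the product of the
kernel `ζ₁` with a pole `℘'` of `u_xx` into a sum whose terms can be integrated over a period, and
the resulting jumps combine so that `T u_xx + T̃ v_xx` becomes a field of `℘'`.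

*Local terms.* What is left of the equation is a double sum over the poles, which collapses by the
three-term identity for `ζ` and `℘` provided that the poles obey the first-order system
`ṗ_j = 2i ∑ r_m ζ₂(p_j - p_m)`.

*Dynamics.* If the poles obey the second-order Calogero–Moser equations, then the defect of the
first-order system solves a linear homogeneous differential equation, again by the three-term
identity. It vanishes at time `0`, hence always.
-/

open scoped PeriodPair

noncomputable section

namespace NcILW

section ZetaRegular

variable (P : PeriodPair)

/-- The Weierstrass `ζ`-function without its pole at the origin. -/
def zetaReg (z : ℂ) : ℂ :=
  ∑' l : P.lattice, if (l : ℂ) = 0 then 0 else (1 / (z - (l : ℂ)) + 1 / (l : ℂ) + z / (l : ℂ) ^ 2)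

lemma norm_zetaSummand_le {r : ℝ} {s l : ℂ} (hs : ‖s‖ < r) (hl : 2 * r ≤ ‖l‖) :
    ‖1 / (s - l) + 1 / l + s / l ^ 2‖ ≤ 2 * r ^ 2 * ‖l‖ ^ (-3 : ℝ) := by
  have hr : 0 < r := (norm_nonneg s).trans_lt hs
  have hl_pos : 0 < ‖l‖ := by linarith
  have hl0 : l ≠ 0 := norm_pos_iff.mp hl_pos
  have hsl : ‖l‖ / 2 ≤ ‖s - l‖ := by
    rw [norm_sub_rev]
    exact .trans (by linarith) (norm_sub_norm_le l s)
  have hsl0 : s - l ≠ 0 := norm_pos_iff.mp (by linarith)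
  have hsummand : 1 / (s - l) + 1 / l + s / l ^ 2 = s ^ 2 / (l ^ 2 * (s - l)) := by
    field_simp
    ring
  have hrpow : ‖l‖ ^ (-3 : ℝ) = 1 / ‖l‖ ^ 3 := by
    rw [Real.rpow_neg hl_pos.le, one_div]
    norm_cast
  rw [hsummand, hrpow, norm_div, norm_mul, norm_pow, norm_pow, mul_one_div,
    div_le_div_iff₀ (by positivity) (by positivity)]
  calc ‖s‖ ^ 2 * ‖l‖ ^ 3 ≤ r ^ 2 * ‖l‖ ^ 3 := by gcongr
    _ = 2 * r ^ 2 * (‖l‖ ^ 2 * (‖l‖ / 2)) := by ring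
    _ ≤ 2 * r ^ 2 * (‖l‖ ^ 2 * ‖s - l‖) := by gcongr

lemma hasSumLocallyUniformly_zetaReg :
    HasSumLocallyUniformly
      (fun (l : P.lattice) (z : ℂ) =>
        if (l : ℂ) = 0 then 0 else (1 / (z - (l : ℂ)) + 1 / (l : ℂ) + z / (l : ℂ) ^ 2))
      (zetaReg P) := by
  refine P.hasSumLocallyUniformly_aux (u := fun r l => 2 * r ^ 2 * ‖l‖ ^ (-3 : ℝ)) _
    (fun _ _ => (ZLattice.summable_norm_rpow _ _ (by simp; norm_num)).mul_left _) fun r _ =>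
    eventually_atTop.mpr ⟨2 * r, ?_⟩
  rintro _ h s hs l rfl
  split_ifs
  · rw [norm_zero]
    positivity
  · exact norm_zetaSummand_le hs h

lemma hasDerivAt_zetaSummand {l z : ℂ} (h : z ≠ l) :
    HasDerivAt (fun z : ℂ => 1 / (z - l) + 1 / l + z / l ^ 2)
      (-(1 / (z - l) ^ 2 - 1 / l ^ 2)) z := by
  have hpole : HasDerivAt (fun z : ℂ => 1 / (z - l)) (-1 / (z - l) ^ 2) z := by
    simpa only [one_div] using! ((hasDerivAt_id z).sub_const l).inv (sub_ne_zero.mpr h)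
  refine ((hpole.add_const (1 / l)).add ((hasDerivAt_id z).div_const (l ^ 2))).congr_deriv ?_
  ring

lemma hasDerivAt_zetaReg_partialSum (s : Finset P.lattice) {z : ℂ}
    (hz : z ∈ ((P.lattice : Set ℂ) \ {0})ᶜ) :
    HasDerivAt (fun z : ℂ => ∑ l ∈ s,
        if (l : ℂ) = 0 then 0 else (1 / (z - (l : ℂ)) + 1 / (l : ℂ) + z / (l : ℂ) ^ 2))
      (-∑ l ∈ s, if (l : ℂ) = 0 then 0 else (1 / (z - (l : ℂ)) ^ 2 - 1 / (l : ℂ) ^ 2)) z := by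
  rw [← Finset.sum_neg_distrib]
  refine .fun_sum fun l _ => ?_
  split_ifs with hl
  · simpa only [neg_zero] using hasDerivAt_const z (0 : ℂ)
  · refine hasDerivAt_zetaSummand ?_
    rintro rfl
    exact hz ⟨l.2, hl⟩

lemma hasDerivAt_zetaReg {z : ℂ} (hz : z ∈ ((P.lattice : Set ℂ) \ {0})ᶜ) :
    HasDerivAt (zetaReg P) (-P.weierstrassPExcept 0 z) z :=
  hasDerivAt_of_tendstoLocallyUniformlyOn P.isOpen_compl_lattice_sdiff
    (P.hasSumLocallyUniformly_weierstrassPExcept 0).tendstoLocallyUniformlyOn.neg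
    (.of_forall fun s _ hy => hasDerivAt_zetaReg_partialSum P s hy)
    (fun _ _ => (hasSumLocallyUniformly_zetaReg P).hasSum) hz

lemma weierstrassZeta_eq_zetaReg_add (z : ℂ) : weierstrassZeta P z = zetaReg P z + 1 / z := by
  have hreg : Summable fun l : P.lattice =>
      (if (l : ℂ) = 0 then 0 else (1 / (z - (l : ℂ)) + 1 / (l : ℂ) + z / (l : ℂ) ^ 2)) :=
    ⟨_, (hasSumLocallyUniformly_zetaReg P).hasSum⟩
  have hpole : HasSum (fun l : P.lattice => if l = 0 then 1 / z else 0) (1 / z) :=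
    hasSum_ite_eq 0 (1 / z)
  rw [zetaReg, ← hpole.tsum_eq, ← hreg.tsum_add hpole.summable, weierstrassZeta]
  congr with l
  by_cases hl : l = 0 <;> simp [hl]

lemma zetaReg_neg (z : ℂ) : zetaReg P (-z) = -zetaReg P z := by
  simp only [zetaReg]
  rw [← (Equiv.neg P.lattice).tsum_eq, ← tsum_neg]
  congr with l
  by_cases hl : (l : ℂ) = 0
  · simp [hl]
  · have hsub : -z - -(l : ℂ) = -(z - l) := by ring
    simp only [Equiv.neg_apply, NegMemClass.coe_neg, neg_eq_zero, hl, if_false, hsub, one_div,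
      inv_neg, even_two, Even.neg_pow, neg_div]
    ring

lemma zetaReg_zero : zetaReg P 0 = 0 := by
  simpa [CharZero.eq_neg_self_iff] using zetaReg_neg P 0

lemma weierstrassZeta_neg (z : ℂ) : weierstrassZeta P (-z) = -weierstrassZeta P z := by
  rw [weierstrassZeta_eq_zetaReg_add, weierstrassZeta_eq_zetaReg_add, zetaReg_neg, div_neg]
  ring

end ZetaRegular

section Zeta

variable {P : PeriodPair}

lemma hasDerivAt_weierstrassZeta {z : ℂ} (hz : z ∉ P.lattice) :
    HasDerivAt (weierstrassZeta P) (-℘[P] z) z := by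
  have hz0 : z ≠ 0 := by rintro rfl; exact hz P.lattice.zero_mem
  have hsum := (hasDerivAt_zetaReg P (z := z) fun h => hz h.1).add (hasDerivAt_inv hz0)
  have hzeta : weierstrassZeta P = zetaReg P + Inv.inv :=
    funext fun y => by simp [weierstrassZeta_eq_zetaReg_add]
  have hP := P.weierstrassPExcept_add 0 z
  simp only [ZeroMemClass.coe_zero, sub_zero] at hP
  rw [hzeta]
  refine hsum.congr_deriv ?_
  rw [← hP]
  simp
  ring

lemma hasDerivAt_weierstrassP {z : ℂ} (hz : z ∉ P.lattice) : HasDerivAt ℘[P] (℘'[P] z) z := by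
  simpa only [P.deriv_weierstrassP] using
    (P.analyticOnNhd_weierstrassP z hz).differentiableAt.hasDerivAt

lemma hasDerivAt_derivWeierstrassP {z : ℂ} (hz : z ∉ P.lattice) :
    HasDerivAt ℘'[P] (deriv ℘'[P] z) z :=
  (P.analyticOnNhd_derivWeierstrassP z hz).differentiableAt.hasDerivAt

lemma add_notMem_lattice {z l : ℂ} (hl : l ∈ P.lattice) (hz : z ∉ P.lattice) :
    z + l ∉ P.lattice :=
  fun h => hz ((P.lattice.add_mem_iff_left hl).mp h)

lemma neg_notMem_lattice {z : ℂ} (hz : z ∉ P.lattice) : -z ∉ P.lattice :=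
  fun h => hz (P.lattice.neg_mem_iff.mp h)

lemma isConnected_compl_lattice : IsConnected ((P.lattice : Set ℂ)ᶜ) :=
  Set.Countable.isConnected_compl_of_one_lt_rank (by simp)
    (countable_of_Lindelof_of_discrete (X := P.lattice))

lemma exists_weierstrassZeta_add_period {l : ℂ} (hl : l ∈ P.lattice) :
    ∃ η : ℂ, ∀ z ∉ P.lattice, weierstrassZeta P (z + l) = weierstrassZeta P z + η := by
  have hshift : ∀ z ∈ (P.lattice : Set ℂ)ᶜ,
      HasDerivAt (fun z => weierstrassZeta P (z + l)) (-℘[P] z) z := by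
    intro z hz
    have h := (hasDerivAt_weierstrassZeta (add_notMem_lattice hl hz)).comp_add_const z l
    rwa [P.weierstrassP_add_coe z ⟨l, hl⟩] at h
  obtain ⟨η, hη⟩ := P.isClosed_lattice.isOpen_compl.exists_eq_add_of_deriv_eq (𝕜 := ℂ)
    isConnected_compl_lattice.isPreconnected
    (fun z hz => (hshift z hz).differentiableAt.differentiableWithinAt)
    (fun z hz => (hasDerivAt_weierstrassZeta hz).differentiableAt.differentiableWithinAt)
    (fun z hz => (hshift z hz).deriv.trans (hasDerivAt_weierstrassZeta hz).deriv.symm)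
  exact ⟨η, fun z hz => hη hz⟩

lemma weierstrassZeta_add_period {l z : ℂ} (hl : l ∈ P.lattice) (hl_half : l / 2 ∉ P.lattice)
    (hz : z ∉ P.lattice) :
    weierstrassZeta P (z + l) = weierstrassZeta P z + 2 * weierstrassZeta P (l / 2) := by
  obtain ⟨η, hη⟩ := exists_weierstrassZeta_add_period hl
  have hneg := hη (-(l / 2)) (neg_notMem_lattice hl_half)
  rw [show -(l / 2) + l = l / 2 by ring, weierstrassZeta_neg] at hneg
  rw [hη z hz]
  linear_combination -hneg

end Zeta

section Liouville

variable {P : PeriodPair}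

lemma eventually_sub_notMem_lattice (b x : ℂ) : ∀ᶠ y in 𝓝[≠] x, y - b ∉ P.lattice := by
  have hlattice : ∀ᶠ y in 𝓝[≠] (x - b), y ∉ P.lattice := by
    filter_upwards [nhdsWithin_le_nhds (P.compl_lattice_sdiff_singleton_mem_nhds (x - b)),
      self_mem_nhdsWithin] with y hy hyx hyl
    exact hy ⟨hyl, hyx⟩
  rwa [← map_subRight_nhdsNE, eventually_map] at hlattice

lemma eventually_notMem_lattice (x : ℂ) : ∀ᶠ y in 𝓝[≠] x, y ∉ P.lattice := by
  simpa only [sub_zero] using eventually_sub_notMem_lattice (P := P) 0 x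

lemma differentiable_of_tendsto_nhdsNE {f F : ℂ → ℂ}
    (hdiff : ∀ x, ∀ᶠ y in 𝓝[≠] x, DifferentiableAt ℂ f y)
    (hlim : ∀ x, Tendsto f (𝓝[≠] x) (𝓝 (F x))) : Differentiable ℂ F := by
  intro x
  have heq : ∀ᶠ y in 𝓝[≠] x, f y = F y := (hdiff x).mono fun y hy =>
    tendsto_nhds_unique (hy.continuousAt.tendsto.mono_left nhdsWithin_le_nhds) (hlim y)
  refine (Complex.analyticAt_of_differentiable_on_punctured_nhds_of_continuousAt ?_
    ?_).differentiableAt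
  · filter_upwards [eventually_eventually_nhdsWithin.mpr heq, hdiff x, self_mem_nhdsWithin]
      with y hy hfy hyx
    rw [isOpen_compl_singleton.nhdsWithin_eq hyx] at hy
    exact hfy.congr_of_eventuallyEq (hy.mono fun _ h => h.symm)
  · rw [← continuousWithinAt_compl_self]
    exact (hlim x).congr' heq

lemma exists_tendsto_const_of_doublyPeriodic {f : ℂ → ℂ}
    (hper : ∀ l ∈ P.lattice, ∀ x, ∀ᶠ y in 𝓝[≠] x, f (y + l) = f y)
    (hdiff : ∀ x, ∀ᶠ y in 𝓝[≠] x, DifferentiableAt ℂ f y)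
    (hlim : ∀ x, ∃ l ∈ P.lattice, ∃ y, Tendsto f (𝓝[≠] (x + l)) (𝓝 y)) :
    ∃ c, ∀ x, Tendsto f (𝓝[≠] x) (𝓝 c) := by
  have hshift : ∀ l ∈ P.lattice, ∀ x y, Tendsto f (𝓝[≠] (x + l)) (𝓝 y) →
      Tendsto f (𝓝[≠] x) (𝓝 y) := by
    intro l hl x y h
    rw [← map_add_right_nhdsNE, tendsto_map'_iff] at h
    exact h.congr' (hper l hl x)
  have hlim' : ∀ x, ∃ y, Tendsto f (𝓝[≠] x) (𝓝 y) := fun x =>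
    let ⟨l, hl, y, hy⟩ := hlim x
    ⟨y, hshift l hl x y hy⟩
  choose F hF using hlim'
  have hFdiff : Differentiable ℂ F := differentiable_of_tendsto_nhdsNE hdiff hF
  have hFper : ∀ z w : ℂ, w ∈ P.lattice → F (z + w) = F z := fun z w hw =>
    tendsto_nhds_unique (hshift w hw z _ (hF (z + w))) (hF z)
  have hbounded := (IsZLattice.isCompact_range_of_periodic P.lattice F hFdiff.continuous
    hFper).isBounded
  exact ⟨F 0, fun x => hFdiff.apply_eq_apply_of_bounded hbounded x 0 ▸ hF x⟩

lemma exists_tendsto_div_sq {f : ℂ → ℂ} (hf : AnalyticAt ℂ f 0) (hf0 : f 0 = 0)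
    (hf'0 : deriv f 0 = 0) : ∃ y, Tendsto (fun z => f z / z ^ 2) (𝓝[≠] 0) (𝓝 y) := by
  obtain ⟨p, hp⟩ := hf
  have hcont : ContinuousAt (dslope (dslope f 0) 0) 0 :=
    hp.has_fpower_series_dslope_fslope.has_fpower_series_dslope_fslope.continuousAt
  refine ⟨_, (hcont.tendsto.mono_left nhdsWithin_le_nhds).congr' ?_⟩
  filter_upwards [self_mem_nhdsWithin] with z hz
  rw [dslope_of_ne _ hz, slope_def_field, dslope_of_ne _ hz, slope_def_field, dslope_same, hf0,
    hf'0]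
  simp only [sub_zero]
  rw [div_div, sq]

end Liouville

section AdditionFormula

variable {P : PeriodPair}

lemma analyticAt_zetaReg_zero : AnalyticAt ℂ (zetaReg P) 0 :=
  DifferentiableOn.analyticAt (s := ((P.lattice : Set ℂ) \ {0})ᶜ)
    (fun _ hz => (hasDerivAt_zetaReg P hz).differentiableAt.differentiableWithinAt)
    (P.isOpen_compl_lattice_sdiff.mem_nhds (by simp))

lemma analyticAt_weierstrassZeta {z : ℂ} (hz : z ∉ P.lattice) :
    AnalyticAt ℂ (weierstrassZeta P) z :=
  DifferentiableOn.analyticAt (s := (P.lattice : Set ℂ)ᶜ)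
    (fun _ hy => (hasDerivAt_weierstrassZeta hy).differentiableAt.differentiableWithinAt)
    (P.isClosed_lattice.isOpen_compl.mem_nhds hz)

variable (P) in
/-- The difference of the two sides of the addition formula
`(ζ(b) + ζ(a - b) - ζ(a)) (℘(a) - ℘(b)) = (℘'(a) + ℘'(b)) / 2`, as a function of `a`. -/
def additionDefect (b a : ℂ) : ℂ :=
  (weierstrassZeta P b + weierstrassZeta P (a - b) - weierstrassZeta P a) * (℘[P] a - ℘[P] b)
    - (℘'[P] a + ℘'[P] b) / 2

lemma differentiableAt_additionDefect {a b : ℂ} (ha : a ∉ P.lattice) (hab : a - b ∉ P.lattice) :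
    DifferentiableAt ℂ (additionDefect P b) a :=
  (((((hasDerivAt_weierstrassZeta hab).comp_sub_const a b).differentiableAt.const_add _).sub
    (hasDerivAt_weierstrassZeta ha).differentiableAt).mul
    ((hasDerivAt_weierstrassP ha).differentiableAt.sub_const _)).sub
    (((hasDerivAt_derivWeierstrassP ha).differentiableAt.add_const _).div_const _)

lemma additionDefect_add_period {a b l : ℂ} (hl : l ∈ P.lattice) (ha : a ∉ P.lattice)
    (hab : a - b ∉ P.lattice) : additionDefect P b (a + l) = additionDefect P b a := by
  obtain ⟨η, hη⟩ := exists_weierstrassZeta_add_period hl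
  have hP : ℘[P] (a + l) = ℘[P] a := P.weierstrassP_add_coe a ⟨l, hl⟩
  have hP' : ℘'[P] (a + l) = ℘'[P] a := P.derivWeierstrassP_add_coe a ⟨l, hl⟩
  simp only [additionDefect, hP, hP', add_sub_right_comm a l b, hη _ ha, hη _ hab]
  ring

lemma additionDefect_eq_of_ne_zero (b : ℂ) {a : ℂ} (ha : a ≠ 0) :
    additionDefect P b a =
      (weierstrassZeta P b + weierstrassZeta P (a - b) - zetaReg P a)
          * (P.weierstrassPExcept 0 a - ℘[P] b)
        - (P.derivWeierstrassPExcept 0 a + ℘'[P] b) / 2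
        + (weierstrassZeta P b + weierstrassZeta P (a - b) - zetaReg P a
            - (P.weierstrassPExcept 0 a - ℘[P] b) * a) / a ^ 2 := by
  have hP := P.weierstrassPExcept_add 0 a
  have hP' := P.derivWeierstrassPExcept_sub 0 a
  simp only [ZeroMemClass.coe_zero, sub_zero] at hP hP'
  rw [additionDefect, ← hP, ← hP', weierstrassZeta_eq_zetaReg_add P a]
  field_simp
  ring

/-- The poles of `ζ(a)`, `℘(a)` and `℘'(a)` at `a = 0` cancel in the addition formula. -/
lemma exists_tendsto_additionDefect_zero {b : ℂ} (hb : b ∉ P.lattice) :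
    ∃ y, Tendsto (additionDefect P b) (𝓝[≠] 0) (𝓝 y) := by
  have hb' : (0 : ℂ) - b ∉ P.lattice := by simpa using hb
  have hP : AnalyticAt ℂ (P.weierstrassPExcept 0) 0 := P.analyticAt_weierstrassPExcept 0
  have hP' : AnalyticAt ℂ (P.derivWeierstrassPExcept 0) 0 :=
    P.analyticAt_derivWeierstrassPExcept 0
  have hreg : AnalyticAt ℂ (zetaReg P) 0 := analyticAt_zetaReg_zero
  have hzeta : AnalyticAt ℂ (fun a => weierstrassZeta P (a - b)) 0 :=
    (analyticAt_weierstrassZeta hb').comp_of_eq (by fun_prop) rfl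
  have hderiv : HasDerivAt (fun a => weierstrassZeta P b + weierstrassZeta P (a - b) - zetaReg P a
      - (P.weierstrassPExcept 0 a - ℘[P] b) * a) 0 0 := by
    refine (((((hasDerivAt_weierstrassZeta hb').comp_sub_const 0 b).const_add _).sub
      (hasDerivAt_zetaReg P (by simp))).sub
      ((hP.differentiableAt.hasDerivAt.sub_const _).mul (hasDerivAt_id 0))).congr_deriv ?_
    simp
  obtain ⟨y, hy⟩ := exists_tendsto_div_sq (by fun_prop)
    (by simp [weierstrassZeta_neg, zetaReg_zero]) hderiv.deriv
  have hregular : ContinuousAt (fun a =>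
      (weierstrassZeta P b + weierstrassZeta P (a - b) - zetaReg P a)
          * (P.weierstrassPExcept 0 a - ℘[P] b)
        - (P.derivWeierstrassPExcept 0 a + ℘'[P] b) / 2) 0 :=
    (((analyticAt_const.add hzeta).sub hreg).mul (hP.sub analyticAt_const)).continuousAt.sub
      ((hP'.continuousAt.add_const _).div_const 2)
  refine ⟨_, ((hregular.tendsto.mono_left nhdsWithin_le_nhds).add hy).congr' ?_⟩
  filter_upwards [self_mem_nhdsWithin] with a ha
  exact (additionDefect_eq_of_ne_zero b ha).symm

lemma tendsto_additionDefect_self {b : ℂ} (hb : b ∉ P.lattice) :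
    Tendsto (additionDefect P b) (𝓝[≠] b) (𝓝 0) := by
  have hcont : ContinuousAt (fun a =>
      (weierstrassZeta P b + zetaReg P (a - b) - weierstrassZeta P a) * (℘[P] a - ℘[P] b)
        + dslope ℘[P] b a - (℘'[P] a + ℘'[P] b) / 2) b := by
    have hreg : ContinuousAt (fun a => zetaReg P (a - b)) b :=
      ContinuousAt.comp_of_eq analyticAt_zetaReg_zero.continuousAt (by fun_prop) (sub_self b)
    have hzeta := (hasDerivAt_weierstrassZeta hb).continuousAt
    have hP := (hasDerivAt_weierstrassP hb).continuousAt
    have hP' := (hasDerivAt_derivWeierstrassP hb).continuousAt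
    have hslope : ContinuousAt (dslope ℘[P] b) b :=
      continuousAt_dslope_same.mpr (hasDerivAt_weierstrassP hb).differentiableAt
    fun_prop
  have hlim := hcont.tendsto.mono_left (nhdsWithin_le_nhds (s := {b}ᶜ))
  simp only [sub_self, zetaReg_zero, add_zero, mul_zero, zero_add, dslope_same,
    P.deriv_weierstrassP, add_self_div_two] at hlim
  refine hlim.congr' ?_
  filter_upwards [self_mem_nhdsWithin] with a ha
  have hab : a - b ≠ 0 := sub_ne_zero.mpr ha
  rw [additionDefect, dslope_of_ne _ ha, slope_def_field, weierstrassZeta_eq_zetaReg_add P (a - b)]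
  field_simp
  ring

lemma exists_tendsto_additionDefect {b : ℂ} (hb : b ∉ P.lattice) (x : ℂ) :
    ∃ l ∈ P.lattice, ∃ y, Tendsto (additionDefect P b) (𝓝[≠] (x + l)) (𝓝 y) := by
  by_cases hx : x ∈ P.lattice
  · exact ⟨-x, P.lattice.neg_mem hx, by simpa using exists_tendsto_additionDefect_zero hb⟩
  by_cases hxb : x - b ∈ P.lattice
  · exact ⟨-(x - b), P.lattice.neg_mem hxb, 0, by simpa using tendsto_additionDefect_self hb⟩
  · refine ⟨0, P.lattice.zero_mem, additionDefect P b x, ?_⟩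
    rw [add_zero]
    exact (differentiableAt_additionDefect hx hxb).continuousAt.tendsto.mono_left
      nhdsWithin_le_nhds

lemma weierstrassZeta_addition {a b : ℂ} (ha : a ∉ P.lattice) (hb : b ∉ P.lattice)
    (hab : a - b ∉ P.lattice) :
    (weierstrassZeta P b + weierstrassZeta P (a - b) - weierstrassZeta P a) * (℘[P] a - ℘[P] b)
      = (℘'[P] a + ℘'[P] b) / 2 := by
  obtain ⟨c, hc⟩ := exists_tendsto_const_of_doublyPeriodic (P := P) (f := additionDefect P b)
    (fun l hl x => by
      filter_upwards [eventually_notMem_lattice x, eventually_sub_notMem_lattice b x] with y hy hyb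
      exact additionDefect_add_period hl hy hyb)
    (fun x => by
      filter_upwards [eventually_notMem_lattice x, eventually_sub_notMem_lattice b x] with y hy hyb
      exact differentiableAt_additionDefect hy hyb)
    (exists_tendsto_additionDefect hb)
  have hc_zero : c = 0 := tendsto_nhds_unique (hc b) (tendsto_additionDefect_self hb)
  have hcont := (differentiableAt_additionDefect ha hab).continuousAt.tendsto
  exact sub_eq_zero.mp <| hc_zero ▸
    tendsto_nhds_unique (hcont.mono_left nhdsWithin_le_nhds) (hc a)

lemma weierstrassZeta_add_mul_sub {t d : ℂ} (ht : t ∉ P.lattice) (hd : d ∉ P.lattice)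
    (hs : t + d ∉ P.lattice) :
    2 * (weierstrassZeta P (t + d) - weierstrassZeta P t - weierstrassZeta P d)
      * (℘[P] t - ℘[P] d) = ℘'[P] t - ℘'[P] d := by
  have h := weierstrassZeta_addition ht (neg_notMem_lattice hd) (by simpa using hs)
  simp only [weierstrassZeta_neg, sub_neg_eq_add, P.weierstrassP_neg,
    P.derivWeierstrassP_neg] at h
  linear_combination 2 * h

/-- The addition formula differentiated in `t` at fixed `t + d`. -/
lemma sq_weierstrassP_sub_add_mul {t d : ℂ} (ht : t ∉ P.lattice) (hd : d ∉ P.lattice)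
    (hs : t + d ∉ P.lattice) :
    2 * (℘[P] t - ℘[P] d) ^ 2
      + 2 * (weierstrassZeta P (t + d) - weierstrassZeta P t - weierstrassZeta P d)
        * (℘'[P] t + ℘'[P] d) = deriv ℘'[P] t + deriv ℘'[P] d := by
  obtain ⟨s, rfl⟩ : ∃ s, d = s - t := ⟨t + d, by ring⟩
  have hlhs := (((((hasDerivAt_weierstrassZeta ht).const_sub (weierstrassZeta P s)).sub
    ((hasDerivAt_weierstrassZeta hd).comp_const_sub s t)).const_mul 2)).mul
    ((hasDerivAt_weierstrassP ht).sub ((hasDerivAt_weierstrassP hd).comp_const_sub s t))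
  have hrhs := (hasDerivAt_derivWeierstrassP ht).sub
    ((hasDerivAt_derivWeierstrassP hd).comp_const_sub s t)
  have hopen : IsOpen ((P.lattice : Set ℂ)ᶜ) := P.isClosed_lattice.isOpen_compl
  have hsub : ContinuousAt (fun x => s - x) t := by fun_prop
  have hunique := hlhs.unique (hrhs.congr_of_eventuallyEq ?_)
  · simp only [Pi.sub_apply] at hunique
    rw [add_sub_cancel]
    linear_combination hunique
  · filter_upwards [hopen.mem_nhds ht, hsub.preimage_mem_nhds (hopen.mem_nhds hd)] with x hx hsx
    have hadd := weierstrassZeta_add_mul_sub hx hsx (by simpa using hs)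
    rw [add_sub_cancel] at hadd
    exact hadd

end AdditionFormula

section ZetaLin

variable (P : PeriodPair) (c : ℂ)

/-- `ζ(z) - c z`: both `ζ₁` and `ζ₂` are of this form. -/
def zetaLin (z : ℂ) : ℂ := weierstrassZeta P z - c * z

/-- The derivative `-℘(z) - c` of `ζ(z) - c z`. -/
def zetaLinDeriv (z : ℂ) : ℂ := -℘[P] z - c

variable {P}

lemma zetaLin_neg (z : ℂ) : zetaLin P c (-z) = -zetaLin P c z := by
  simp only [zetaLin, weierstrassZeta_neg]
  ring

lemma zetaLin_sub_comm (a b : ℂ) : zetaLin P c (a - b) = -zetaLin P c (b - a) := by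
  rw [← zetaLin_neg, neg_sub]

lemma zetaLin_zero : zetaLin P c 0 = 0 := by
  simpa [CharZero.eq_neg_self_iff] using zetaLin_neg (P := P) c 0

lemma hasDerivAt_zetaLin {z : ℂ} (hz : z ∉ P.lattice) :
    HasDerivAt (zetaLin P c) (zetaLinDeriv P c z) z := by
  have h := (hasDerivAt_weierstrassZeta hz).sub ((hasDerivAt_id z).const_mul c)
  rwa [mul_one] at h

lemma hasDerivAt_zetaLinDeriv {z : ℂ} (hz : z ∉ P.lattice) :
    HasDerivAt (zetaLinDeriv P c) (-℘'[P] z) z :=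
  (hasDerivAt_weierstrassP hz).neg.sub_const c

lemma exists_zetaLin_add_period {l : ℂ} (hl : l ∈ P.lattice) :
    ∃ η : ℂ, ∀ z ∉ P.lattice, zetaLin P c (z + l) = zetaLin P c z + η := by
  obtain ⟨η, hη⟩ := exists_weierstrassZeta_add_period hl
  refine ⟨η - c * l, fun z hz => ?_⟩
  rw [zetaLin, zetaLin, hη z hz]
  ring

lemma zetaLin_three_term {a b : ℂ} (ha : a ∉ P.lattice) (hb : b ∉ P.lattice)
    (hab : a - b ∉ P.lattice) :
    zetaLinDeriv P c a * (zetaLin P c b + zetaLin P c (a - b))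
        + zetaLinDeriv P c b * (zetaLin P c a + zetaLin P c (b - a))
      = (zetaLin P c a * zetaLinDeriv P c a - ℘'[P] a / 2)
        + (zetaLin P c b * zetaLinDeriv P c b - ℘'[P] b / 2) := by
  have h := weierstrassZeta_addition ha hb hab
  rw [zetaLin_sub_comm c b a]
  simp only [zetaLin, zetaLinDeriv]
  linear_combination -h

end ZetaLin

section PoleDynamics

variable {P : PeriodPair} (c : ℂ) {ι : Type*}

lemma sum_sum_mul_of_add_swap [DecidableEq ι] {R : Type*} [Field R] [CharZero R] (s : Finset ι)
    {r F D : ι → R} {f : ι → ι → R}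
    (hf : ∀ m ∈ s, ∀ l ∈ s, f m l + f l m = F m + F l + if m = l then D m else 0) :
    ∑ m ∈ s, ∑ l ∈ s, r m * r l * f m l
      = (∑ l ∈ s, r l) * (∑ m ∈ s, r m * F m) + 1 / 2 * ∑ m ∈ s, r m ^ 2 * D m := by
  have hF_left : ∑ m ∈ s, ∑ l ∈ s, r m * r l * F m = (∑ l ∈ s, r l) * ∑ m ∈ s, r m * F m := by
    rw [Finset.sum_mul_sum, Finset.sum_comm]
    exact Finset.sum_congr rfl fun _ _ => Finset.sum_congr rfl fun _ _ => by ring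
  have hF_right : ∑ m ∈ s, ∑ l ∈ s, r m * r l * F l = (∑ l ∈ s, r l) * ∑ m ∈ s, r m * F m := by
    rw [Finset.sum_mul_sum]
    exact Finset.sum_congr rfl fun _ _ => Finset.sum_congr rfl fun _ _ => by ring
  have hD : ∑ m ∈ s, ∑ l ∈ s, r m * r l * (if m = l then D m else 0)
      = ∑ m ∈ s, r m ^ 2 * D m := by
    refine Finset.sum_congr rfl fun m hm => ?_
    simp only [mul_ite, mul_zero, Finset.sum_ite_eq, if_pos hm, sq]
  have hdouble := calc
    2 * ∑ m ∈ s, ∑ l ∈ s, r m * r l * f m l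
      = ∑ m ∈ s, ∑ l ∈ s, r m * r l * f m l + ∑ m ∈ s, ∑ l ∈ s, r l * r m * f l m := by
        rw [two_mul, Finset.sum_comm (f := fun m l => r l * r m * f l m)]
    _ = ∑ m ∈ s, ∑ l ∈ s, r m * r l * (f m l + f l m) := by
        simp only [mul_add, Finset.sum_add_distrib, mul_comm (r _) (r _)]
    _ = ∑ m ∈ s, ∑ l ∈ s, r m * r l * (F m + F l + if m = l then D m else 0) :=
        Finset.sum_congr rfl fun m hm => Finset.sum_congr rfl fun l hl => by rw [hf m hm l hl]
    _ = (∑ l ∈ s, r l) * (∑ m ∈ s, r m * F m) + (∑ l ∈ s, r l) * (∑ m ∈ s, r m * F m)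
          + ∑ m ∈ s, r m ^ 2 * D m := by
        rw [← hD]
        nth_rw 1 [← hF_left]
        rw [← hF_right]
        simp only [← Finset.sum_add_distrib, ← mul_add]
  linear_combination hdouble / 2

lemma sum_sum_zetaLin_three_term (s : Finset ι) (r p : ι → ℂ) (x : ℂ)
    (hx : ∀ m ∈ s, x - p m ∉ P.lattice)
    (hp : ∀ m ∈ s, ∀ l ∈ s, m ≠ l → p m - p l ∉ P.lattice) :
    ∑ m ∈ s, ∑ l ∈ s, r m * r l *
        (zetaLinDeriv P c (x - p m) * (zetaLin P c (x - p l) + zetaLin P c (p l - p m)))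
      = (∑ l ∈ s, r l) * (∑ m ∈ s, r m *
          (zetaLin P c (x - p m) * zetaLinDeriv P c (x - p m) - ℘'[P] (x - p m) / 2))
        + 1 / 2 * ∑ m ∈ s, r m ^ 2 * ℘'[P] (x - p m) := by
  classical
  refine sum_sum_mul_of_add_swap s fun m hm l hl => ?_
  by_cases hml : m = l
  · subst hml
    simp only [if_pos, sub_self, zetaLin_zero]
    ring
  · have hpp := hp l hl m hm (Ne.symm hml)
    rw [← sub_sub_sub_cancel_left _ _ x] at hpp
    have h := zetaLin_three_term c (hx m hm) (hx l hl) hpp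
    rw [sub_sub_sub_cancel_left, sub_sub_sub_cancel_left] at h
    rwa [if_neg hml, add_zero]

variable [Fintype ι]

variable (P) in
/-- The velocity `2i ∑_{m ≠ j} r_m ζ(q_j - q_m)` which the Bäcklund transformation prescribes for
the pole `q_j` in the field of the charges `r_m` at `q_m`. The term `m = j` of the sum below is
`ζ(0) = 0`. -/
def poleVelocity (r q : ι → ℂ) (j : ι) : ℂ :=
  2 * Complex.I * ∑ m, r m * zetaLin P c (q j - q m)

lemma poleVelocity_sub (r q : ι → ℂ) (j m : ι) :
    poleVelocity P c r q j - poleVelocity P c r q m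
      = 2 * Complex.I * ∑ l, r l * (zetaLin P c (q j - q l) + zetaLin P c (q l - q m)) := by
  rw [poleVelocity, poleVelocity, ← mul_sub, ← Finset.sum_sub_distrib]
  simp only [mul_add, zetaLin_sub_comm c (q m) _, mul_neg, sub_neg_eq_add]

/-- The left side is the derivative of the prescribed velocity along its own flow. For charges
`±1` the factor `r_m² + r_j r_m` vanishes on opposite charges, so the two species decouple. -/
lemma sum_zetaLinDeriv_mul_poleVelocity_sub {r q : ι → ℂ} (hr : ∑ m, r m = 0)
    (hq : ∀ m l, m ≠ l → q m - q l ∉ P.lattice) (j : ι) :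
    2 * Complex.I * ∑ m, r m * (zetaLinDeriv P c (q j - q m)
        * (poleVelocity P c r q j - poleVelocity P c r q m))
      = -2 * ∑ m, (r m ^ 2 + r j * r m) * ℘'[P] (q j - q m) := by
  classical
  have hthree := sum_sum_zetaLin_three_term c (Finset.univ.erase j) r q (q j)
    (fun m hm => hq j m (Finset.ne_of_mem_erase hm).symm) (fun m _ l _ => hq m l)
  have hcharge : ∑ m ∈ Finset.univ.erase j, r m = -r j := by
    linear_combination Finset.add_sum_erase Finset.univ r (Finset.mem_univ j) + hr
  have hvelocity : ∀ m, r m * (zetaLinDeriv P c (q j - q m)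
        * (poleVelocity P c r q j - poleVelocity P c r q m))
      = 2 * Complex.I * (r m * r j * (zetaLinDeriv P c (q j - q m) * zetaLin P c (q j - q m))
        + ∑ l ∈ Finset.univ.erase j, r m * r l * (zetaLinDeriv P c (q j - q m)
          * (zetaLin P c (q j - q l) + zetaLin P c (q l - q m)))) := by
    intro m
    rw [poleVelocity_sub, ← Finset.add_sum_erase _ _ (Finset.mem_univ j), sub_self, zetaLin_zero]
    simp only [mul_assoc, ← Finset.mul_sum, mul_left_comm (r _) (zetaLinDeriv P c _)]
    ring
  have herase_left : ∑ m, r m * (zetaLinDeriv P c (q j - q m)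
        * (poleVelocity P c r q j - poleVelocity P c r q m))
      = ∑ m ∈ Finset.univ.erase j, r m * (zetaLinDeriv P c (q j - q m)
        * (poleVelocity P c r q j - poleVelocity P c r q m)) :=
    (Finset.sum_erase _ (by rw [sub_self (poleVelocity _ _ _ _ _), mul_zero, mul_zero])).symm
  have herase_right : ∑ m, (r m ^ 2 + r j * r m) * ℘'[P] (q j - q m)
      = ∑ m ∈ Finset.univ.erase j, (r m ^ 2 + r j * r m) * ℘'[P] (q j - q m) :=
    (Finset.sum_erase _ (by rw [sub_self, P.derivWeierstrassP_zero, mul_zero])).symm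
  rw [herase_left, herase_right, Finset.sum_congr rfl fun m _ => hvelocity m, ← Finset.mul_sum,
    Finset.sum_add_distrib, hthree, hcharge]
  simp only [Finset.mul_sum, ← Finset.sum_add_distrib]
  refine Finset.sum_congr rfl fun m _ => ?_
  linear_combination (2 * (r m ^ 2 + r j * r m) * ℘'[P] (q j - q m)) * Complex.I_sq

lemma pole_ansatz_identity {r p : ι → ℂ} (hr : ∑ m, r m = 0)
    (hp : ∀ m l, m ≠ l → p m - p l ∉ P.lattice) {x : ℂ} (hx : ∀ m, x - p m ∉ P.lattice) :
    Complex.I * ∑ m, r m * (zetaLinDeriv P c (x - p m) * -poleVelocity P c r p m)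
      + 2 * (Complex.I * ∑ m, r m * zetaLin P c (x - p m))
          * (Complex.I * ∑ m, r m * zetaLinDeriv P c (x - p m))
      = -∑ m, r m ^ 2 * ℘'[P] (x - p m) := by
  have hthree := sum_sum_zetaLin_three_term c Finset.univ r p x (fun m _ => hx m)
    (fun m _ l _ => hp m l)
  have hpole : ∀ m, Complex.I * (r m * (zetaLinDeriv P c (x - p m) * -poleVelocity P c r p m))
      + 2 * (Complex.I * ∑ l, r l * zetaLin P c (x - p l))
          * (Complex.I * (r m * zetaLinDeriv P c (x - p m)))
      = -2 * ∑ l, r m * r l *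
        (zetaLinDeriv P c (x - p m) * (zetaLin P c (x - p l) + zetaLin P c (p l - p m))) := by
    intro m
    simp only [poleVelocity, zetaLin_sub_comm c (p m) _, mul_assoc, ← Finset.mul_sum,
      mul_left_comm (r _) (zetaLinDeriv P c _), mul_add, Finset.sum_add_distrib, mul_neg,
      Finset.sum_neg_distrib]
    linear_combination (2 * r m * zetaLinDeriv P c (x - p m) * (∑ l, r l * zetaLin P c (x - p l)
      + ∑ l, r l * zetaLin P c (p l - p m))) * Complex.I_sq
  rw [Finset.mul_sum, Finset.mul_sum Finset.univ (fun m => r m * zetaLinDeriv P c (x - p m)),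
    Finset.mul_sum, ← Finset.sum_add_distrib, Finset.sum_congr rfl fun m _ => hpole m,
    ← Finset.mul_sum, hthree, hr]
  ring

end PoleDynamics

section Propagation

lemma eq_zero_right_of_norm_deriv_le_mul {E : Type*} [NormedAddCommGroup E] [NormedSpace ℝ E]
    {f f' : ℝ → E} {C : ℝ → ℝ} {a b : ℝ} (hC : ContinuousOn C (Set.Icc a b))
    (hf : ∀ t ∈ Set.Icc a b, HasDerivAt f (f' t) t)
    (bound : ∀ t ∈ Set.Icc a b, ‖f' t‖ ≤ C t * ‖f t‖) (ha : f a = 0) (hab : a ≤ b) : f b = 0 := by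
  obtain ⟨K, hK⟩ := isCompact_Icc.exists_bound_of_continuousOn hC
  refine eq_zero_of_abs_deriv_le_mul_abs_self_of_eq_zero_right (K := K)
    (fun t ht => (hf t ht).continuousAt.continuousWithinAt)
    (fun t ht => (hf t (Set.Ico_subset_Icc_self ht)).hasDerivWithinAt) ha (fun t ht => ?_) b
    ⟨hab, le_rfl⟩
  have ht' := Set.Ico_subset_Icc_self ht
  exact (bound t ht').trans
    (mul_le_mul_of_nonneg_right ((le_abs_self _).trans (hK t ht')) (norm_nonneg _))

lemma eq_zero_of_norm_deriv_le_mul {E : Type*} [NormedAddCommGroup E] [NormedSpace ℝ E]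
    {I : Set ℝ} (hI : I.OrdConnected) {f f' : ℝ → E} {C : ℝ → ℝ} (hC : ContinuousOn C I)
    (hf : ∀ t ∈ I, HasDerivAt f (f' t) t) (bound : ∀ t ∈ I, ‖f' t‖ ≤ C t * ‖f t‖)
    {t₀ t : ℝ} (ht₀ : t₀ ∈ I) (h0 : f t₀ = 0) (ht : t ∈ I) : f t = 0 := by
  rcases le_total t₀ t with h | h
  · have hsub : Set.Icc t₀ t ⊆ I := hI.out ht₀ ht
    exact eq_zero_right_of_norm_deriv_le_mul (hC.mono hsub) (fun s hs => hf s (hsub hs))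
      (fun s hs => bound s (hsub hs)) h0 h
  · have hsub : Set.MapsTo Neg.neg (Set.Icc (-t₀) (-t)) I := fun s hs =>
      hI.out ht ht₀ ⟨le_neg_of_le_neg hs.2, neg_le_of_neg_le hs.1⟩
    have hreversed := eq_zero_right_of_norm_deriv_le_mul (f := fun s => f (-s))
      (f' := fun s => -f' (-s)) (C := fun s => C (-s))
      (hC.comp continuousOn_neg hsub)
      (fun s hs => by simpa using! (hf _ (hsub hs)).scomp s (hasDerivAt_neg s))
      (fun s hs => by simpa only [norm_neg] using bound _ (hsub hs))
      (by rwa [neg_neg]) (neg_le_neg h)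
    rwa [neg_neg] at hreversed

variable {P : PeriodPair} (c : ℂ) {ι : Type*}

lemma continuousAt_zetaLinDeriv_sub {q : ι → ℝ → ℂ} {t : ℝ}
    (hq : ∀ m l, m ≠ l → q m t - q l t ∉ P.lattice) (hd : ∀ j, ContinuousAt (q j) t) (j m : ι) :
    ContinuousAt (fun s => zetaLinDeriv P c (q j s - q m s)) t := by
  by_cases hjm : j = m
  · subst hjm
    simpa only [sub_self] using continuousAt_const
  · exact ContinuousAt.comp_of_eq (hasDerivAt_zetaLinDeriv c (hq j m hjm)).continuousAt
      ((hd j).sub (hd m)) rfl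

variable [Fintype ι]

lemma hasDerivAt_poleVelocity (r : ι → ℂ) {q : ι → ℝ → ℂ} {t : ℝ}
    (hq : ∀ m l, m ≠ l → q m t - q l t ∉ P.lattice) (hd : ∀ j, DifferentiableAt ℝ (q j) t)
    (j : ι) :
    HasDerivAt (fun s => poleVelocity P c r (fun m => q m s) j)
      (2 * Complex.I * ∑ m, r m * (zetaLinDeriv P c (q j t - q m t)
        * (deriv (q j) t - deriv (q m) t))) t := by
  refine (HasDerivAt.fun_sum fun m _ => HasDerivAt.const_mul _ ?_).const_mul _
  by_cases hjm : j = m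
  · subst hjm
    simpa only [sub_self, mul_zero] using hasDerivAt_const t (zetaLin P c 0)
  · exact (hasDerivAt_zetaLin c (hq j m hjm)).comp t
      ((hd j).hasDerivAt.sub (hd m).hasDerivAt)

lemma norm_sum_mul_sub_le (a : ι → ι → ℂ) (x : ι → ℂ) (j : ι) :
    ‖∑ m, a j m * (x j - x m)‖ ≤ (∑ l, ∑ m, 2 * ‖a l m‖) * ‖x‖ := by
  have hterm : ∀ m, ‖a j m * (x j - x m)‖ ≤ 2 * ‖a j m‖ * ‖x‖ := fun m => by
    rw [norm_mul]
    nlinarith [norm_nonneg (a j m), norm_sub_le (x j) (x m), norm_le_pi_norm x j,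
      norm_le_pi_norm x m]
  calc ‖∑ m, a j m * (x j - x m)‖ ≤ ∑ m, 2 * ‖a j m‖ * ‖x‖ := norm_sum_le_of_le _ fun m _ => hterm m
    _ = (∑ m, 2 * ‖a j m‖) * ‖x‖ := by rw [Finset.sum_mul]
    _ ≤ (∑ l, ∑ m, 2 * ‖a l m‖) * ‖x‖ :=
      mul_le_mul_of_nonneg_right (Finset.single_le_sum (f := fun l => ∑ m, 2 * ‖a l m‖)
        (fun l _ => by positivity) (Finset.mem_univ j)) (norm_nonneg x)

/-- The defect `q̇ - poleVelocity` of the first-order dynamics solves a homogeneous linear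
equation. -/
lemma deriv_eq_poleVelocity {r : ι → ℂ} {q : ι → ℝ → ℂ} (hr : ∑ m, r m = 0)
    {I : Set ℝ} (hI : I.OrdConnected)
    (hq : ∀ t ∈ I, ∀ m l, m ≠ l → q m t - q l t ∉ P.lattice)
    (hd : ∀ t ∈ I, ∀ j, DifferentiableAt ℝ (q j) t)
    (hdd : ∀ t ∈ I, ∀ j, HasDerivAt (deriv (q j))
      (-2 * ∑ m, (r m ^ 2 + r j * r m) * ℘'[P] (q j t - q m t)) t)
    {t₀ t : ℝ} (ht₀ : t₀ ∈ I)
    (h0 : ∀ j, deriv (q j) t₀ = poleVelocity P c r (fun m => q m t₀) j) (ht : t ∈ I) (j : ι) :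
    deriv (q j) t = poleVelocity P c r (fun m => q m t) j := by
  set D : ℝ → ι → ℂ := fun s j => deriv (q j) s - poleVelocity P c r (fun m => q m s) j with hD
  set a : ℝ → ι → ι → ℂ := fun s j m =>
    -2 * Complex.I * (r m * zetaLinDeriv P c (q j s - q m s)) with ha
  have hderiv : ∀ s ∈ I, HasDerivAt D (fun j => ∑ m, a s j m * (D s j - D s m)) s := by
    refine fun s hs => hasDerivAt_pi.mpr fun j => ?_
    refine ((hdd s hs j).sub (hasDerivAt_poleVelocity c r (hq s hs) (hd s hs) j)).congr_deriv ?_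
    rw [← sum_zetaLinDeriv_mul_poleVelocity_sub c hr (hq s hs) j, ← mul_sub,
      ← Finset.sum_sub_distrib, Finset.mul_sum]
    refine Finset.sum_congr rfl fun m _ => ?_
    simp only [hD, ha]
    ring
  have hcont : ContinuousOn (fun s => ∑ l, ∑ m, 2 * ‖a s l m‖) I := fun s hs =>
    ContinuousAt.continuousWithinAt <| tendsto_finsetSum _ fun l _ => tendsto_finsetSum _
      fun m _ => ((((continuousAt_zetaLinDeriv_sub c (hq s hs)
        (fun j => (hd s hs j).continuousAt) l m).const_mul _).const_mul _).norm).const_mul _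
  have hzero := eq_zero_of_norm_deriv_le_mul hI hcont hderiv
    (fun s _ => (pi_norm_le_iff_of_nonneg (by positivity)).mpr (norm_sum_mul_sub_le (a s) (D s)))
    ht₀ (funext fun j => sub_eq_zero.mpr (h0 j)) ht
  exact sub_eq_zero.mp (congrFun hzero j)

end Propagation

section LineIntegral

lemma intervalIntegral_eq_zero_of_odd {E : Type*} [NormedAddCommGroup E] [NormedSpace ℝ E]
    {f : ℝ → E} (hf : Function.Odd f) (a : ℝ) : ∫ x in (-a)..a, f x = 0 := by
  have h := intervalIntegral.integral_comp_neg (a := -a) (b := a) f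
  simp only [hf _, intervalIntegral.integral_neg, neg_neg] at h
  exact (smul_eq_zero.mp (show (2 : ℝ) • ∫ x in (-a)..a, f x = 0 by
    rw [two_smul, add_eq_zero_iff_eq_neg, h])).resolve_left two_ne_zero

lemma integral_line_eq_of_periodic {E : Type*} [NormedAddCommGroup E] [NormedSpace ℂ E]
    [CompleteSpace E] {f : ℂ → E} {T c d : ℝ}
    (hf : ∀ z : ℂ, z.im ∈ Set.uIcc c d → DifferentiableAt ℂ f z)
    (hper : ∀ z : ℂ, z.im ∈ Set.uIcc c d → f (z + T) = f z) (a : ℝ) :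
    ∫ x : ℝ in a..(a + T), f (x + c * Complex.I)
      = ∫ x : ℝ in a..(a + T), f (x + d * Complex.I) := by
  have hrect := Complex.integral_boundary_rect_eq_zero_of_differentiableOn f ⟨a, c⟩ ⟨a + T, d⟩
    fun z hz => (hf z hz.2).differentiableWithinAt
  have hsides : ∫ y : ℝ in c..d, f ((a + T : ℝ) + y * Complex.I)
      = ∫ y : ℝ in c..d, f (a + y * Complex.I) :=
    intervalIntegral.integral_congr fun y hy => by
      have h := hper (a + y * Complex.I) (by simpa using hy)
      rwa [add_right_comm, ← Complex.ofReal_add] at h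
  rw [hsides, add_sub_cancel_right] at hrect
  exact sub_eq_zero.mp hrect

lemma tendsto_integral_line {E : Type*} [NormedAddCommGroup E] [NormedSpace ℝ E]
    {g : ℂ → E} {a b c₀ : ℝ} (hc₀ : 0 < c₀)
    (hg : ∀ z ∈ Set.uIcc a b ×ℂ Set.Icc 0 c₀, ContinuousAt g z) :
    Tendsto (fun c : ℝ => ∫ x : ℝ in a..b, g (x + c * Complex.I)) (𝓝[>] 0)
      (𝓝 (∫ x : ℝ in a..b, g x)) := by
  obtain ⟨C, hC⟩ := (isCompact_uIcc.reProdIm isCompact_Icc).exists_bound_of_continuousOn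
    fun z hz => (hg z hz).continuousWithinAt
  have hmem : ∀ x ∈ Set.uIcc a b, ∀ c ∈ Set.Icc 0 c₀,
      (x : ℂ) + c * Complex.I ∈ Set.uIcc a b ×ℂ Set.Icc 0 c₀ := fun x hx c hc => by
    simpa [Complex.mem_reProdIm] using ⟨hx, hc⟩
  have hsmall : ∀ᶠ c in 𝓝[>] (0 : ℝ), c ∈ Set.Icc 0 c₀ :=
    eventually_of_mem (Ioo_mem_nhdsGT hc₀) fun c hc => Set.Ioo_subset_Icc_self hc
  refine intervalIntegral.tendsto_integral_filter_of_dominated_convergence (fun _ => C) ?_ ?_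
    intervalIntegrable_const (ae_of_all _ fun x hx => ?_)
  · filter_upwards [hsmall] with c hc
    refine ContinuousOn.aestronglyMeasurable (fun x hx => ?_) measurableSet_uIoc
    exact (ContinuousAt.comp_of_eq (g := g) (f := fun x : ℝ => (x : ℂ) + c * Complex.I)
      (hg _ (hmem x (Set.uIoc_subset_uIcc hx) c hc)) (by fun_prop) rfl).continuousWithinAt
  · filter_upwards [hsmall] with c hc
    exact ae_of_all _ fun x hx => hC _ (hmem x (Set.uIoc_subset_uIcc hx) c hc)
  · have hpath : Tendsto (fun c : ℝ => (x : ℂ) + c * Complex.I) (𝓝[>] 0) (𝓝 x) := by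
      have h : Continuous fun c : ℝ => (x : ℂ) + c * Complex.I := by fun_prop
      simpa using (h.tendsto 0).mono_left nhdsWithin_le_nhds
    refine Tendsto.comp (ContinuousAt.tendsto (hg _ ?_)) hpath
    simpa using hmem x (Set.uIoc_subset_uIcc hx) 0 ⟨le_rfl, hc₀.le⟩

lemma intervalIntegrable_inv_add_mul_I {c : ℝ} (hc : c ≠ 0) (a b : ℝ) :
    IntervalIntegrable (fun x : ℝ => 1 / ((x : ℂ) + c * Complex.I)) volume a b := by
  refine Continuous.intervalIntegrable (continuous_const.div (by fun_prop) fun x h => hc ?_) _ _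
  simpa using congrArg Complex.im h

lemma integral_inv_add_mul_I {c : ℝ} (hc : c ≠ 0) (a b : ℝ) :
    ∫ x : ℝ in a..b, 1 / ((x : ℂ) + c * Complex.I)
      = Complex.log (b + c * Complex.I) - Complex.log (a + c * Complex.I) := by
  have hderiv : ∀ x : ℝ, HasDerivAt (fun x : ℝ => Complex.log (x + c * Complex.I))
      (1 / ((x : ℂ) + c * Complex.I)) x := fun x =>
    (Complex.ofRealCLM.hasDerivAt.add_const _).clog_real (Or.inr (by simpa using hc))
  exact intervalIntegral.integral_eq_sub_of_hasDerivAt (fun x _ => hderiv x)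
    (intervalIntegrable_inv_add_mul_I hc a b)

lemma tendsto_integral_inv_add_mul_I {a : ℝ} (ha : 0 < a) :
    Tendsto (fun c : ℝ => ∫ x : ℝ in (-a)..a, 1 / ((x : ℂ) + c * Complex.I)) (𝓝[>] 0)
      (𝓝 (-(Real.pi * Complex.I))) := by
  have hpath : ∀ b : ℝ, Tendsto (fun c : ℝ => (b : ℂ) + c * Complex.I) (𝓝[>] 0)
      (𝓝[{z : ℂ | 0 ≤ z.im}] b) := fun b => by
    have h : Continuous fun c : ℝ => (b : ℂ) + c * Complex.I := by fun_prop
    refine tendsto_nhdsWithin_iff.mpr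
      ⟨by simpa using (h.tendsto 0).mono_left nhdsWithin_le_nhds, ?_⟩
    filter_upwards [self_mem_nhdsWithin] with c hc
    simpa using le_of_lt hc
  have hright : Tendsto (fun c : ℝ => Complex.log (a + c * Complex.I)) (𝓝[>] 0)
      (𝓝 (Complex.log a)) :=
    (continuousAt_clog (Complex.ofReal_mem_slitPlane.mpr ha)).tendsto.comp
      ((hpath a).mono_right nhdsWithin_le_nhds)
  have hleft : Tendsto (fun c : ℝ => Complex.log ((-a : ℝ) + c * Complex.I)) (𝓝[>] 0)
      (𝓝 (Real.log ‖((-a : ℝ) : ℂ)‖ + Real.pi * Complex.I)) :=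
    (Complex.tendsto_log_nhdsWithin_im_nonneg_of_re_neg_of_im_zero (by simpa using ha)
      (Complex.ofReal_im _)).comp (hpath (-a))
  have hlim := hright.sub hleft
  rw [Complex.norm_real, norm_neg, Real.norm_of_nonneg ha.le, Complex.ofReal_log ha.le,
    sub_add_cancel_left] at hlim
  refine hlim.congr' ?_
  filter_upwards [self_mem_nhdsWithin] with c hc
  rw [integral_inv_add_mul_I (ne_of_gt hc)]

end LineIntegral

section ProductOfKernelAndPole

variable {P : PeriodPair} (c : ℂ)

variable (P) in
/-- The part of `ζ(t + d) ℘'(t)` which is regular at `t = -d`, for `ζ` replaced by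
`ζ(z) - c z`. -/
def regularPart (d t : ℂ) : ℂ :=
  ℘'[P] d * zetaLin P c t + zetaLin P c t * ℘'[P] t - ℘[P] t ^ 2 + zetaLin P c d * ℘'[P] t
    + 2 * ℘[P] d * ℘[P] t + deriv ℘'[P] t / 2
    + (℘'[P] d * zetaLin P c d - ℘[P] d ^ 2 + deriv ℘'[P] d / 2)

lemma zetaLin_mul_derivWeierstrassP {t d : ℂ} (ht : t ∉ P.lattice) (hd : d ∉ P.lattice)
    (htd : t + d ∉ P.lattice) :
    zetaLin P c (t + d) * ℘'[P] t = -℘'[P] d * zetaLin P c (t + d) + regularPart P c d t := by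
  have h := sq_weierstrassP_sub_add_mul ht hd htd
  simp only [regularPart, zetaLin]
  linear_combination h / 2

variable (P) in
/-- A primitive of `regularPart` up to a multiple of `zetaLin` and a constant. -/
def regularPrimitive (d t : ℂ) : ℂ :=
  zetaLin P c t * ℘[P] t + zetaLin P c d * ℘[P] t + ℘'[P] t / 2
    - (c + 2 * ℘[P] d) * zetaLin P c t

variable (P) in
/-- The mean value of `regularPart` over a period of `zetaLin`, up to a multiple of that of
`zetaLin`. -/
def regularMean (d : ℂ) : ℂ :=
  ℘'[P] d * zetaLin P c d - ℘[P] d ^ 2 + deriv ℘'[P] d / 2 - c * (c + 2 * ℘[P] d)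

lemma hasDerivAt_regularPrimitive (d : ℂ) {t : ℂ} (ht : t ∉ P.lattice) :
    HasDerivAt (regularPrimitive P c d)
      (regularPart P c d t - ℘'[P] d * zetaLin P c t - regularMean P c d) t := by
  have hzeta := hasDerivAt_zetaLin c ht
  have hwp := hasDerivAt_weierstrassP ht
  have hwp' := hasDerivAt_derivWeierstrassP ht
  refine ((((hzeta.mul hwp).add (hwp.const_mul (zetaLin P c d))).add (hwp'.div_const 2)).sub
    (hzeta.const_mul (c + 2 * ℘[P] d))).congr_deriv ?_
  simp only [regularPart, regularMean, zetaLinDeriv]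
  ring

lemma continuousAt_regularPart (d : ℂ) {t : ℂ} (ht : t ∉ P.lattice) :
    ContinuousAt (regularPart P c d) t := by
  have hzeta := (hasDerivAt_zetaLin c ht).continuousAt
  have hwp := (hasDerivAt_weierstrassP ht).continuousAt
  have hwp' := (hasDerivAt_derivWeierstrassP ht).continuousAt
  have hwp'' := (P.analyticOnNhd_derivWeierstrassP.deriv t ht).continuousAt
  unfold regularPart
  fun_prop

end ProductOfKernelAndPole

section PeriodicZeta

/-- The slope `2ζ(ω/2)/ω` of the linear term which has to be subtracted from `ζ` to make it
`ω`-periodic. -/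
def zetaSlope (P : PeriodPair) (ω : ℂ) : ℂ := weierstrassZeta P (ω / 2) / (ω / 2)

lemma zeta₁_eq_zetaLin (P : PeriodPair) : zeta₁ P = zetaLin P (zetaSlope P P.ω₁) := rfl

lemma zeta₂_eq_zetaLin (P : PeriodPair) : zeta₂ P = zetaLin P (zetaSlope P P.ω₂) := rfl

lemma zetaLin_zetaSlope_add {P : PeriodPair} {ω z : ℂ} (hω : ω ∈ P.lattice)
    (hω_half : ω / 2 ∉ P.lattice) (hz : z ∉ P.lattice) :
    zetaLin P (zetaSlope P ω) (z + ω) = zetaLin P (zetaSlope P ω) z := by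
  have hω_ne : ω / 2 ≠ 0 := ne_of_mem_of_not_mem P.lattice.zero_mem hω_half |>.symm
  rw [zetaLin, zetaLin, weierstrassZeta_add_period hω hω_half hz, zetaSlope]
  linear_combination -2 * div_mul_cancel₀ (weierstrassZeta P (ω / 2)) hω_ne

lemma zeta₁_add_ω₁ {P : PeriodPair} {z : ℂ} (hz : z ∉ P.lattice) :
    zeta₁ P (z + P.ω₁) = zeta₁ P z :=
  zetaLin_zetaSlope_add P.ω₁_mem_lattice P.ω₁_div_two_notMem_lattice hz

lemma zeta₂_add_ω₂ {P : PeriodPair} {z : ℂ} (hz : z ∉ P.lattice) :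
    zeta₂ P (z + P.ω₂) = zeta₂ P z :=
  zetaLin_zetaSlope_add P.ω₂_mem_lattice P.ω₂_div_two_notMem_lattice hz

lemma zeta₁_neg (P : PeriodPair) (z : ℂ) : zeta₁ P (-z) = -zeta₁ P z := zetaLin_neg _ z

lemma continuousAt_zeta₁ {P : PeriodPair} {z : ℂ} (hz : z ∉ P.lattice) :
    ContinuousAt (zeta₁ P) z :=
  (hasDerivAt_zetaLin _ hz).continuousAt

end PeriodicZeta

section RectangularLattice

variable {L δ : ℝ} (hL : 0 < L) (hδ : 0 < δ)

local notation "Λ" => PeriodPair.lattice (periods L δ hL hδ)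

lemma mem_lattice_periods {z : ℂ} :
    z ∈ Λ ↔ ∃ m n : ℤ, z = m * L + n * (2 * Complex.I * δ) := by
  rw [PeriodPair.mem_lattice]
  simp only [periods, eq_comm]

lemma ofReal_mem_lattice_iff {x : ℝ} : (x : ℂ) ∈ Λ ↔ (x : AddCircle L) = 0 := by
  rw [mem_lattice_periods, AddCircle.coe_eq_zero_iff]
  refine ⟨fun ⟨m, n, h⟩ => ⟨m, ?_⟩, fun ⟨m, h⟩ => ⟨m, 0, ?_⟩⟩
  · simpa using (congrArg Complex.re h).symm
  · simp [← h]

lemma exists_im_eq_of_mem_lattice {z : ℂ} (hz : z ∈ Λ) : ∃ n : ℤ, z.im = 2 * δ * n := by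
  obtain ⟨m, n, rfl⟩ := (mem_lattice_periods hL hδ).mp hz
  exact ⟨n, by simp [mul_comm]⟩

lemma two_mul_mul_intCast_notMem_Ioo (n : ℤ) : 2 * δ * n ∉ Set.Ioo 0 (2 * δ) := fun h => by
  have hδ : 0 < 2 * δ := h.1.trans h.2
  have hpos : (0 : ℝ) < n := (mul_pos_iff_of_pos_left hδ).mp h.1
  have hlt : (n : ℝ) < 1 := (mul_lt_iff_lt_one_right hδ).mp h.2
  norm_cast at hpos hlt
  lia

lemma notMem_lattice_of_units_mul_im_sub_mem_Ioo (s : ℤˣ) (n : ℤ) {z : ℂ}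
    (hz : (s : ℝ) * (z.im - 2 * δ * n) ∈ Set.Ioo 0 (2 * δ)) : z ∉ Λ := fun h => by
  obtain ⟨k, hk⟩ := exists_im_eq_of_mem_lattice hL hδ h
  have hmultiple : 2 * δ * ((s * (k - n) : ℤ) : ℝ) = (s : ℝ) * (z.im - 2 * δ * n) := by
    rw [hk]
    push_cast
    ring
  exact two_mul_mul_intCast_notMem_Ioo (s * (k - n)) (hmultiple ▸ hz)

lemma notMem_lattice_of_im_mem_Ioo {z : ℂ} (hz : z.im ∈ Set.Ioo 0 (2 * δ)) : z ∉ Λ :=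
  notMem_lattice_of_units_mul_im_sub_mem_Ioo hL hδ 1 0 (by simpa using hz)

lemma eq_zero_of_mem_lattice {z : ℂ} (hz : z ∈ Λ)
    (hre : |z.re| ≤ L / 2) (him : z.im ∈ Set.Ico 0 (2 * δ)) : z = 0 := by
  have him_zero : z.im = 0 := by
    by_contra h
    exact notMem_lattice_of_im_mem_Ioo hL hδ ⟨lt_of_le_of_ne him.1 (Ne.symm h), him.2⟩ hz
  have hz_real : z = (z.re : ℂ) := Complex.ext rfl him_zero
  rw [hz_real, ofReal_mem_lattice_iff] at hz
  have hnorm :=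
    (AddCircle.norm_coe_eq_abs_iff (x := z.re) L hL.ne').mpr (by rwa [abs_of_pos hL])
  rw [hz, norm_zero, eq_comm, abs_eq_zero] at hnorm
  rw [hz_real, hnorm, Complex.ofReal_zero]

end RectangularLattice

section IntegralOverLine

variable {L δ : ℝ} (hL : 0 < L) (hδ : 0 < δ)

local notation "𝔓" => periods L δ hL hδ
local notation "Λ" => PeriodPair.lattice (periods L δ hL hδ)

lemma zeta₁_add_L {z : ℂ} (hz : z ∉ Λ) : zeta₁ 𝔓 (z + L) = zeta₁ 𝔓 z :=
  zeta₁_add_ω₁ hz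

variable (L δ) in
/-- The integral of `ζ₁` over one period of the horizontal line through `q`. -/
def lineIntegral (q : ℂ) : ℂ := ∫ x : ℝ in (-(L / 2))..(L / 2), zeta₁ 𝔓 (x + q)

lemma periodic_zeta₁_line {q : ℂ} (hq : ∀ x : ℝ, (x : ℂ) + q ∉ Λ) :
    Function.Periodic (fun x : ℝ => zeta₁ 𝔓 (x + q)) L := fun x => by
  simp only [Complex.ofReal_add, add_right_comm _ (L : ℂ), zeta₁_add_L hL hδ (hq x)]

lemma lineIntegral_add_ofReal {q : ℂ} (hq : ∀ x : ℝ, (x : ℂ) + q ∉ Λ) (s : ℝ) :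
    lineIntegral L δ hL hδ (q + s) = lineIntegral L δ hL hδ q := by
  have hshift := (periodic_zeta₁_line hL hδ hq).intervalIntegral_add_eq (-(L / 2) + s) (-(L / 2))
  have hright : -(L / 2) + L = L / 2 := by ring
  rw [add_right_comm, hright] at hshift
  rw [lineIntegral, lineIntegral, ← hshift, ← intervalIntegral.integral_comp_add_right _ s]
  refine intervalIntegral.integral_congr fun x _ => ?_
  simp only [Complex.ofReal_add, add_right_comm, add_assoc]

lemma lineIntegral_neg (q : ℂ) : lineIntegral L δ hL hδ (-q) = -lineIntegral L δ hL hδ q := by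
  have h := intervalIntegral.integral_comp_neg (a := -(L / 2)) (b := L / 2)
    fun x : ℝ => zeta₁ 𝔓 (x + -q)
  rw [neg_neg] at h
  rw [lineIntegral, ← h, lineIntegral, ← intervalIntegral.integral_neg]
  refine intervalIntegral.integral_congr fun x _ => ?_
  simp only [← zeta₁_neg, neg_add, Complex.ofReal_neg]

lemma lineIntegral_eq_of_im_pos {c d : ℝ} (hc : c ∈ Set.Ioo 0 (2 * δ))
    (hd : d ∈ Set.Ioo 0 (2 * δ)) :
    lineIntegral L δ hL hδ (c * Complex.I) = lineIntegral L δ hL hδ (d * Complex.I) := by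
  have hstrip : ∀ z : ℂ, z.im ∈ Set.uIcc c d → z ∉ Λ := fun z hz =>
    notMem_lattice_of_im_mem_Ioo hL hδ (Set.ordConnected_Ioo.uIcc_subset hc hd hz)
  have h := integral_line_eq_of_periodic (f := zeta₁ 𝔓) (T := L)
    (fun z hz => (hasDerivAt_zetaLin _ (hstrip z hz)).differentiableAt)
    (fun z hz => zeta₁_add_L hL hδ (hstrip z hz)) (-(L / 2))
  rwa [neg_add_eq_sub, sub_half] at h

/-- Near the origin `ζ₁` is an odd regular function plus `1/z`, so as the line approaches the real
axis only the integral of `1/z` survives. -/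
lemma tendsto_lineIntegral :
    Tendsto (fun c : ℝ => lineIntegral L δ hL hδ (c * Complex.I)) (𝓝[>] 0)
      (𝓝 (-(Real.pi * Complex.I))) := by
  let g : ℂ → ℂ := fun z => zetaReg 𝔓 z - zetaSlope 𝔓 (periods L δ hL hδ).ω₁ * z
  have hg : ∀ z ∈ Set.uIcc (-(L / 2)) (L / 2) ×ℂ Set.Icc 0 δ, ContinuousAt g z := by
    intro z hz
    rw [Set.uIcc_of_le (by linarith)] at hz
    have hz_reg : z ∈ ((Λ : Set ℂ) \ {0})ᶜ := fun h => h.2 <|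
      eq_zero_of_mem_lattice hL hδ h.1 (abs_le.mpr hz.1) ⟨hz.2.1, by linarith [hz.2.2]⟩
    exact (hasDerivAt_zetaReg 𝔓 hz_reg).continuousAt.sub (by fun_prop)
  have hg_odd : Function.Odd fun x : ℝ => g x := fun x => by
    simp only [g, Complex.ofReal_neg, zetaReg_neg]
    ring
  have hlim := (tendsto_integral_line hδ hg).add
    (tendsto_integral_inv_add_mul_I (half_pos hL))
  rw [intervalIntegral_eq_zero_of_odd hg_odd, zero_add] at hlim
  refine hlim.congr' ?_
  filter_upwards [Ioo_mem_nhdsGT hδ] with c hc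
  rw [lineIntegral, ← intervalIntegral.integral_add _
    (intervalIntegrable_inv_add_mul_I hc.1.ne' _ _)]
  · refine intervalIntegral.integral_congr fun x _ => ?_
    simp only [g, zeta₁_eq_zetaLin, zetaLin, weierstrassZeta_eq_zetaReg_add]
    ring
  · refine ContinuousOn.intervalIntegrable fun x hx => ?_
    refine (ContinuousAt.comp_of_eq (g := g) (f := fun x : ℝ => (x : ℂ) + c * Complex.I)
      (hg _ ?_) (by fun_prop) rfl).continuousWithinAt
    simpa [Complex.mem_reProdIm] using ⟨hx, hc.1.le, hc.2.le⟩

lemma lineIntegral_of_im_mem_Ioo {q : ℂ} (hq : q.im ∈ Set.Ioo 0 (2 * δ)) :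
    lineIntegral L δ hL hδ q = -(Real.pi * Complex.I) := by
  have hline : ∀ x : ℝ, (x : ℂ) + q.im * Complex.I ∉ Λ := fun x =>
    notMem_lattice_of_im_mem_Ioo hL hδ (by simpa using hq)
  rw [← Complex.re_add_im q, add_comm, lineIntegral_add_ofReal hL hδ hline]
  refine tendsto_nhds_unique (tendsto_const_nhds.congr' ?_) (tendsto_lineIntegral hL hδ)
  filter_upwards [Ioo_mem_nhdsGT (by positivity : 0 < 2 * δ)] with c hc
  exact lineIntegral_eq_of_im_pos hL hδ hq hc

lemma lineIntegral_eq (s : ℤˣ) {q : ℂ} (hq : (s : ℝ) * q.im ∈ Set.Ioo 0 (2 * δ)) :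
    lineIntegral L δ hL hδ q = -(s * Real.pi * Complex.I) := by
  obtain rfl | rfl := Int.units_eq_one_or s
  · simpa using lineIntegral_of_im_mem_Ioo hL hδ (by simpa using hq)
  · rw [← neg_neg q, lineIntegral_neg, lineIntegral_of_im_mem_Ioo hL hδ (by simpa using hq)]
    simp

end IntegralOverLine

section PrincipalValue

lemma lt_norm_coe_addCircle_iff {L y ε : ℝ} :
    ε < ‖(y : AddCircle L)‖ ↔ ∀ n : ℤ, ε < |y - n * L| := by
  refine ⟨fun h n => h.trans_le ?_, fun h => AddCircle.norm_eq L ▸ h _⟩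
  have hcoe : (y : AddCircle L) = (y - n * L : ℝ) := by
    rw [AddCircle.coe_sub, ← zsmul_eq_mul, AddCircle.coe_zsmul, AddCircle.coe_period, smul_zero,
      sub_zero]
  rw [hcoe]
  exact QuotientAddGroup.norm_mk_le_norm

lemma truncatedInterval_eq_inter (L x ε : ℝ) :
    truncatedInterval L x ε
      = Set.Icc (-(L / 2)) (L / 2) ∩ {x' | ε < ‖((x' - x : ℝ) : AddCircle L)‖} := by
  ext x'
  simp only [truncatedInterval, Set.mem_inter_iff, Set.mem_ofPred_eq, lt_norm_coe_addCircle_iff]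

lemma continuous_norm_coe_addCircle_sub (L x : ℝ) :
    Continuous fun x' : ℝ => ‖((x' - x : ℝ) : AddCircle L)‖ :=
  ((AddCircle.continuous_mk' L).comp (continuous_sub_right x)).norm

lemma measurableSet_lt_norm_coe_addCircle_sub (L x ε : ℝ) :
    MeasurableSet {x' : ℝ | ε < ‖((x' - x : ℝ) : AddCircle L)‖} :=
  (isOpen_lt continuous_const (continuous_norm_coe_addCircle_sub L x)).measurableSet

lemma measurableSet_truncatedInterval (L x ε : ℝ) : MeasurableSet (truncatedInterval L x ε) :=
  truncatedInterval_eq_inter L x ε ▸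
    measurableSet_Icc.inter (measurableSet_lt_norm_coe_addCircle_sub L x ε)

lemma setIntegral_truncatedInterval_eq_zero_of_odd {E : Type*} [NormedAddCommGroup E]
    [NormedSpace ℝ E] {L ε : ℝ} (hL : 0 ≤ L) (hε : 0 ≤ ε) {h : ℝ → E} (hodd : Function.Odd h)
    (hper : ∀ y : ℝ, (y : AddCircle L) ≠ 0 → h (y + L) = h y) (x : ℝ) :
    ∫ x' in truncatedInterval L x ε, h (x' - x) = 0 := by
  classical
  let k : ℝ → E := fun y => if ε < ‖(y : AddCircle L)‖ then h y else 0
  have hk_per : Function.Periodic k L := fun y => by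
    simp only [k, AddCircle.coe_add_period]
    refine ite_congr rfl (fun hy => hper y ?_) fun _ => rfl
    exact norm_pos_iff.mp (hε.trans_lt hy)
  have hk_odd : Function.Odd k := fun y => by
    simp only [k, AddCircle.coe_neg, norm_neg, hodd y, neg_ite, neg_zero]
  have hk_zero : ∫ x' in (-(L / 2))..(L / 2), k (x' - x) = 0 := by
    have hshift := hk_per.intervalIntegral_add_eq (-(L / 2) - x) (-(L / 2))
    have hright : -(L / 2) + L = L / 2 := by ring
    rw [sub_add_eq_add_sub, hright, intervalIntegral_eq_zero_of_odd hk_odd] at hshift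
    rw [intervalIntegral.integral_comp_sub_right, hshift]
  rw [intervalIntegral.integral_of_le (by linarith), ← integral_Icc_eq_integral_Ioc] at hk_zero
  rw [truncatedInterval_eq_inter,
    ← setIntegral_indicator (measurableSet_lt_norm_coe_addCircle_sub L x ε), ← hk_zero]
  rfl

lemma ae_coe_addCircle_sub_ne_zero (L x : ℝ) : ∀ᵐ x' : ℝ, ((x' - x : ℝ) : AddCircle L) ≠ 0 := by
  have hcount : (Set.range fun n : ℤ => n • L + x).Countable := Set.countable_range _
  filter_upwards [hcount.ae_notMem volume] with x' hx' h
  obtain ⟨n, hn⟩ := (AddCircle.coe_eq_zero_iff L).mp h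
  exact hx' ⟨n, by simp only [hn, sub_add_cancel]⟩

lemma tendsto_setIntegral_truncatedInterval {E : Type*} [NormedAddCommGroup E] [NormedSpace ℝ E]
    {L : ℝ} {R : ℝ → E} (hL : 0 ≤ L) (hR : IntegrableOn R (Set.Icc (-(L / 2)) (L / 2))) (x : ℝ) :
    Tendsto (fun ε : ℝ => ∫ x' in truncatedInterval L x ε, R x') (𝓝[>] 0)
      (𝓝 (∫ x' in (-(L / 2))..(L / 2), R x')) := by
  have hcover : AECover (volume.restrict (Set.Icc (-(L / 2)) (L / 2))) (𝓝[>] (0 : ℝ))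
      fun ε => {x' | ε < ‖((x' - x : ℝ) : AddCircle L)‖} := by
    refine ⟨ae_restrict_of_ae ?_, measurableSet_lt_norm_coe_addCircle_sub L x⟩
    filter_upwards [ae_coe_addCircle_sub_ne_zero L x] with x' hx'
    filter_upwards [Ioo_mem_nhdsGT (norm_pos_iff.mpr hx')] with ε hε using hε.2
  rw [intervalIntegral.integral_of_le (by linarith), ← integral_Icc_eq_integral_Ioc]
  refine (hcover.integral_tendsto_of_countably_generated hR).congr fun ε => ?_
  rw [Measure.restrict_restrict (measurableSet_lt_norm_coe_addCircle_sub L x ε), Set.inter_comm,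
    ← truncatedInterval_eq_inter]

variable {L δ : ℝ} (hL : 0 < L) (hδ : 0 < δ)

local notation "𝔓" => periods L δ hL hδ
local notation "Λ" => PeriodPair.lattice (periods L δ hL hδ)

lemma sub_notMem_lattice_of_norm_pos {x x' : ℝ} (h : 0 < ‖((x' - x : ℝ) : AddCircle L)‖) :
    (x' : ℂ) - x ∉ Λ := by
  rwa [← Complex.ofReal_sub, ofReal_mem_lattice_iff, ← ne_eq, ← norm_pos_iff]

lemma setIntegral_truncatedInterval_zeta₁ {ε : ℝ} (hε : 0 ≤ ε) (x : ℝ) :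
    ∫ x' in truncatedInterval L x ε, zeta₁ 𝔓 ((x' : ℂ) - x) = 0 := by
  have h := setIntegral_truncatedInterval_eq_zero_of_odd (h := fun y : ℝ => zeta₁ 𝔓 y) hL.le hε
    (fun y => by simp only [Complex.ofReal_neg, zeta₁_neg])
    (fun y hy => by
      rw [Complex.ofReal_add, zeta₁_add_L hL hδ (mt (ofReal_mem_lattice_iff hL hδ).mp hy)]) x
  simpa only [Complex.ofReal_sub] using h

lemma integrableOn_truncatedInterval_zeta₁ {ε : ℝ} (hε : 0 < ε) (x : ℝ) :
    IntegrableOn (fun x' : ℝ => zeta₁ 𝔓 ((x' : ℂ) - x)) (truncatedInterval L x ε) := by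
  have hcompact : IsCompact
      (Set.Icc (-(L / 2)) (L / 2) ∩ {x' | ε ≤ ‖((x' - x : ℝ) : AddCircle L)‖}) :=
    isCompact_Icc.inter_right
      (isClosed_le continuous_const (continuous_norm_coe_addCircle_sub L x))
  rw [truncatedInterval_eq_inter]
  refine IntegrableOn.mono_set (ContinuousOn.integrableOn_compact hcompact fun x' hx' => ?_)
    (Set.inter_subset_inter_right _ <| Set.ofPred_subset_ofPred.mpr fun _ => le_of_lt)
  exact (ContinuousAt.comp_of_eq (f := fun x' : ℝ => (x' : ℂ) - x)
    (continuousAt_zeta₁ (sub_notMem_lattice_of_norm_pos hL hδ (hε.trans_le hx'.2)))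
    (by fun_prop) rfl).continuousWithinAt

/-- Only the regular part of the integrand contributes to the principal value, because each
truncated integral of the odd periodic kernel vanishes. -/
lemma hasT_of_eq_mul_zeta₁_add {f R : ℝ → ℂ} {x : ℝ} {A : ℂ} (hR : Continuous R)
    (hf : ∀ x' : ℝ, (x' : ℂ) - x ∉ Λ →
      zeta₁ 𝔓 ((x' : ℂ) - x) * f x' = A * zeta₁ 𝔓 ((x' : ℂ) - x) + R x') :
    HasT L δ hL hδ f x (1 / (Real.pi : ℂ) * ∫ x' in (-(L / 2))..(L / 2), R x') := by
  have hzeta_int : ∀ ε : ℝ, 0 < ε → IntegrableOn (fun x' : ℝ => A * zeta₁ 𝔓 ((x' : ℂ) - x))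
      (truncatedInterval L x ε) := fun ε hε =>
    (integrableOn_truncatedInterval_zeta₁ hL hδ hε x).const_mul A
  have hR_Icc : IntegrableOn R (Set.Icc (-(L / 2)) (L / 2)) :=
    hR.continuousOn.integrableOn_compact isCompact_Icc
  have hR_int : ∀ ε : ℝ, IntegrableOn R (truncatedInterval L x ε) := fun ε =>
    hR_Icc.mono_set fun _ h => h.1
  have heq : ∀ ε : ℝ, 0 < ε → Set.EqOn (fun x' : ℝ => zeta₁ 𝔓 ((x' : ℂ) - x) * f x')
      (fun x' : ℝ => A * zeta₁ 𝔓 ((x' : ℂ) - x) + R x') (truncatedInterval L x ε) :=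
    fun ε hε x' hx' => hf x' <| sub_notMem_lattice_of_norm_pos hL hδ <|
      hε.trans (lt_norm_coe_addCircle_iff.mpr hx'.2)
  refine ⟨fun ε hε => ?_, ?_⟩
  · exact IntegrableOn.congr_fun ((hzeta_int ε hε).add (hR_int ε)) (heq ε hε).symm
      (measurableSet_truncatedInterval L x ε)
  · refine ((tendsto_setIntegral_truncatedInterval hL.le hR_Icc x).const_mul _).congr' ?_
    filter_upwards [self_mem_nhdsWithin] with ε hε
    rw [setIntegral_congr_fun (measurableSet_truncatedInterval L x ε) (heq ε hε),
      integral_add (hzeta_int ε hε) (hR_int ε), integral_const_mul,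
      setIntegral_truncatedInterval_zeta₁ hL hδ (le_of_lt hε), mul_zero, zero_add]

end PrincipalValue

section IntegralOperators

variable {L δ : ℝ} (hL : 0 < L) (hδ : 0 < δ)

local notation "𝔓" => periods L δ hL hδ
local notation "Λ" => PeriodPair.lattice (periods L δ hL hδ)
local notation "κ" => zetaSlope (periods L δ hL hδ) (PeriodPair.ω₁ (periods L δ hL hδ))

lemma continuous_comp_line {P : PeriodPair} {E : Type*} [TopologicalSpace E] {g : ℂ → E} {q : ℂ}
    (hg : ∀ z ∉ P.lattice, ContinuousAt g z) (hq : ∀ x : ℝ, (x : ℂ) + q ∉ P.lattice) :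
    Continuous fun x : ℝ => g (x + q) :=
  continuous_iff_continuousAt.mpr fun x => ContinuousAt.comp_of_eq
    (f := fun x : ℝ => (x : ℂ) + q) (hg _ (hq x)) (by fun_prop) rfl

lemma regularPrimitive_add_L (d : ℂ) {t : ℂ} (ht : t ∉ Λ) :
    regularPrimitive 𝔓 κ d (t + L) = regularPrimitive 𝔓 κ d t := by
  have hL_mem : (L : ℂ) ∈ Λ := (periods L δ hL hδ).ω₁_mem_lattice
  have hzeta : zetaLin 𝔓 κ (t + L) = zetaLin 𝔓 κ t := zeta₁_add_L hL hδ ht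
  rw [regularPrimitive, regularPrimitive, hzeta, PeriodPair.weierstrassP_add_coe _ t ⟨L, hL_mem⟩,
    PeriodPair.derivWeierstrassP_add_coe _ t ⟨L, hL_mem⟩]

lemma integral_regularPart (d : ℂ) {q : ℂ} (hq : ∀ x : ℝ, (x : ℂ) + q ∉ Λ) :
    ∫ x : ℝ in (-(L / 2))..(L / 2), regularPart 𝔓 κ d (x + q)
      = ℘'[𝔓] d * lineIntegral L δ hL hδ q + L * regularMean 𝔓 κ d := by
  have hderiv : ∀ x : ℝ, HasDerivAt (fun x : ℝ => regularPrimitive 𝔓 κ d (x + q))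
      (regularPart 𝔓 κ d (x + q) - ℘'[𝔓] d * zeta₁ 𝔓 (x + q) - regularMean 𝔓 κ d) x := fun x => by
    simpa using! (hasDerivAt_regularPrimitive κ d (hq x)).scomp x
      (Complex.ofRealCLM.hasDerivAt.add_const q)
  have hregular : Continuous fun x : ℝ => regularPart 𝔓 κ d (x + q) :=
    continuous_comp_line (fun _ => continuousAt_regularPart κ d) hq
  have hzeta : Continuous fun x : ℝ => ℘'[𝔓] d * zeta₁ 𝔓 (x + q) :=
    (continuous_comp_line (fun _ => continuousAt_zeta₁) hq).const_mul _
  have hdifference : Continuous fun x : ℝ =>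
      regularPart 𝔓 κ d (x + q) - ℘'[𝔓] d * zeta₁ 𝔓 (x + q) := hregular.sub hzeta
  have hFTC := intervalIntegral.integral_eq_sub_of_hasDerivAt (a := -(L / 2)) (b := L / 2)
    (fun x _ => hderiv x) ((hdifference.sub continuous_const).intervalIntegrable _ _)
  have hends : ((L / 2 : ℝ) : ℂ) + q = ((-(L / 2) : ℝ) : ℂ) + q + L := by push_cast; ring
  have hlength : L / 2 - -(L / 2) = L := by ring
  rw [hends, regularPrimitive_add_L hL hδ d (hq _), sub_self,
    intervalIntegral.integral_sub (hdifference.intervalIntegrable _ _)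
      (continuous_const.intervalIntegrable _ _),
    intervalIntegral.integral_sub (hregular.intervalIntegrable _ _)
      (hzeta.intervalIntegrable _ _),
    intervalIntegral.integral_const_mul, intervalIntegral.integral_const, hlength,
    Complex.real_smul] at hFTC
  rw [lineIntegral]
  linear_combination hFTC

lemma hasT_derivWeierstrassP {p : ℂ} (hp : ∀ x : ℝ, (x : ℂ) + -p ∉ Λ) (x : ℝ) :
    HasT L δ hL hδ (fun x' : ℝ => ℘'[𝔓] (x' - p)) x
      (1 / (Real.pi : ℂ) * (℘'[𝔓] (p - x) * lineIntegral L δ hL hδ (-p)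
        + L * regularMean 𝔓 κ (p - x))) := by
  have hd : p - x ∉ Λ := by simpa [← sub_eq_add_neg] using neg_notMem_lattice (hp x)
  rw [← integral_regularPart hL hδ (p - x) hp]
  refine hasT_of_eq_mul_zeta₁_add hL hδ (A := -℘'[𝔓] (p - x))
    (continuous_comp_line (fun _ => continuousAt_regularPart κ (p - x)) hp) fun x' hx' => ?_
  have hsum : (x' : ℂ) + -p + (p - x) = x' - x := by ring
  have h := zetaLin_mul_derivWeierstrassP κ (hp x') hd (by rwa [hsum])
  rwa [hsum, ← sub_eq_add_neg] at h

lemma hasTtilde_derivWeierstrassP {p : ℂ} (hp : ∀ x : ℝ, (x : ℂ) + -p ∉ Λ)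
    (hp' : ∀ x : ℝ, (x : ℂ) + (Complex.I * δ - p) ∉ Λ) (x : ℝ) :
    HasTtilde L δ hL hδ (fun x' : ℝ => ℘'[𝔓] (x' + Complex.I * δ - p)) x
      (1 / (Real.pi : ℂ) * (-℘'[𝔓] (p - x) * lineIntegral L δ hL hδ (Complex.I * δ)
        + (℘'[𝔓] (p - x) * lineIntegral L δ hL hδ (Complex.I * δ - p)
          + L * regularMean 𝔓 κ (p - x)))) := by
  have hI : ∀ y : ℝ, (y : ℂ) + Complex.I * δ ∉ Λ := fun y =>
    notMem_lattice_of_im_mem_Ioo hL hδ ⟨by simpa using hδ, by simp; linarith⟩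
  have hIx : ∀ y : ℝ, (y : ℂ) + (Complex.I * δ + (-x : ℝ)) ∉ Λ := fun y => by
    have hshift : (y : ℂ) + (Complex.I * δ + (-x : ℝ)) = (y - x : ℝ) + Complex.I * δ := by
      push_cast
      ring
    exact hshift ▸ hI (y - x)
  have hd : p - x ∉ Λ := by simpa [← sub_eq_add_neg] using neg_notMem_lattice (hp x)
  have hsplit : ∀ x' : ℝ, zeta₁ 𝔓 (x' - x + Complex.I * δ) * ℘'[𝔓] (x' + Complex.I * δ - p)
      = -℘'[𝔓] (p - x) * zeta₁ 𝔓 (x' + (Complex.I * δ + (-x : ℝ)))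
        + regularPart 𝔓 κ (p - x) (x' + (Complex.I * δ - p)) := fun x' => by
    have hsum : (x' : ℂ) + (Complex.I * δ - p) + (p - x) = x' + (Complex.I * δ + (-x : ℝ)) := by
      push_cast
      ring
    have hker : (x' : ℂ) - x + Complex.I * δ = x' + (Complex.I * δ + (-x : ℝ)) := by
      push_cast
      ring
    have h := zetaLin_mul_derivWeierstrassP κ (hp' x') hd (hsum ▸ hIx x')
    rw [hsum] at h
    rwa [hker, add_sub_assoc]
  have hzeta : Continuous fun x' : ℝ =>
      -℘'[𝔓] (p - x) * zeta₁ 𝔓 (x' + (Complex.I * δ + (-x : ℝ))) :=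
    (continuous_comp_line (fun _ => continuousAt_zeta₁) hIx).const_mul _
  have hregular : Continuous fun x' : ℝ => regularPart 𝔓 κ (p - x) (x' + (Complex.I * δ - p)) :=
    continuous_comp_line (fun _ => continuousAt_regularPart κ (p - x)) hp'
  simp only [HasTtilde, hsplit]
  refine ⟨(hzeta.add hregular).intervalIntegrable _ _, ?_⟩
  rw [intervalIntegral.integral_add (hzeta.intervalIntegrable _ _)
    (hregular.intervalIntegrable _ _), intervalIntegral.integral_const_mul,
    integral_regularPart hL hδ (p - x) hp', ← lineIntegral_add_ofReal hL hδ hI (-x)]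
  rfl

lemma HasT.sum {hL : 0 < L} {hδ : 0 < δ} {ι : Type*} [Fintype ι] {f : ι → ℝ → ℂ} {x : ℝ}
    {Y : ι → ℂ} (a : ι → ℂ) (h : ∀ m, HasT L δ hL hδ (f m) x (Y m)) :
    HasT L δ hL hδ (fun x' => ∑ m, a m * f m x') x (∑ m, a m * Y m) := by
  have hintegrable := fun (ε : ℝ) (hε : 0 < ε) (m : ι) => ((h m).1 ε hε).const_mul (a m)
  simp only [HasT, Finset.mul_sum, mul_left_comm (zeta₁ _ _) (a _)]
  refine ⟨fun ε hε => integrable_finsetSum _ fun m _ => hintegrable ε hε m, ?_⟩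
  refine (tendsto_finsetSum _ fun m _ => (h m).2.const_mul (a m)).congr' ?_
  filter_upwards [self_mem_nhdsWithin] with ε hε
  rw [integral_finsetSum _ fun m _ => hintegrable ε hε m, Finset.mul_sum]
  exact Finset.sum_congr rfl fun m _ => by rw [integral_const_mul, mul_left_comm]

lemma HasTtilde.sum {hL : 0 < L} {hδ : 0 < δ} {ι : Type*} [Fintype ι] {f : ι → ℝ → ℂ} {x : ℝ}
    {Y : ι → ℂ} (a : ι → ℂ) (h : ∀ m, HasTtilde L δ hL hδ (f m) x (Y m)) :
    HasTtilde L δ hL hδ (fun x' => ∑ m, a m * f m x') x (∑ m, a m * Y m) := by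
  have hintegrable := fun m => (h m).1.const_mul (a m)
  simp only [HasTtilde, Finset.mul_sum, mul_left_comm (zeta₁ _ _) (a _)]
  refine ⟨?_, ?_⟩
  · simpa only [Finset.sum_fn] using IntervalIntegrable.sum Finset.univ fun m _ => hintegrable m
  · rw [intervalIntegral.integral_finsetSum fun m _ => hintegrable m, Finset.mul_sum]
    exact Finset.sum_congr rfl fun m _ => by
      rw [intervalIntegral.integral_const_mul, mul_left_comm, (h m).2]

end IntegralOperators

section JumpRelation

/-- A pole `p` of charge `s` is admissible if, up to a multiple of the period `2iδ`, it lies in the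
strip `-δ < Im p < 0` when `s = 1` and in the strip `0 < Im p < δ` when `s = -1`. -/
def IsAdmissiblePole (δ : ℝ) (s : ℤˣ) (p : ℂ) : Prop :=
  ∃ n : ℤ, (s : ℝ) * (p.im - 2 * δ * n) ∈ Set.Ioo (-δ) 0

lemma IsAdmissiblePole.sub_I_mul {δ : ℝ} {s : ℤˣ} {p : ℂ} (h : IsAdmissiblePole δ s p) :
    IsAdmissiblePole δ (-s) (p - Complex.I * δ) := by
  obtain ⟨n, hn⟩ := h
  obtain rfl | rfl := Int.units_eq_one_or s
  · refine ⟨n - 1, ?_⟩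
    simp only [Units.val_one, Int.cast_one, one_mul, Set.mem_Ioo] at hn
    constructor <;> simp <;> linarith
  · refine ⟨n, ?_⟩
    simp only [Units.val_neg, Units.val_one, Int.cast_neg, Int.cast_one, Set.mem_Ioo] at hn
    constructor <;> simp <;> linarith

variable {L δ : ℝ} (hL : 0 < L) (hδ : 0 < δ)

local notation "𝔓" => periods L δ hL hδ
local notation "Λ" => PeriodPair.lattice (periods L δ hL hδ)

lemma two_I_mul_mem_lattice : 2 * Complex.I * δ ∈ Λ := (periods L δ hL hδ).ω₂_mem_lattice

lemma IsAdmissiblePole.ofReal_sub_notMem_lattice {s : ℤˣ} {p : ℂ} (h : IsAdmissiblePole δ s p)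
    (x : ℝ) : (x : ℂ) - p ∉ Λ := by
  obtain ⟨n, hn⟩ := h
  refine notMem_lattice_of_units_mul_im_sub_mem_Ioo hL hδ s (-n) ?_
  have him : (s : ℝ) * (((x : ℂ) - p).im - 2 * δ * (-n : ℤ)) = -(s * (p.im - 2 * δ * n)) := by
    simp
    ring
  rw [him]
  constructor <;> linarith [hn.1, hn.2]

lemma IsAdmissiblePole.sub_notMem_lattice {s : ℤˣ} {p q : ℂ} (hp : IsAdmissiblePole δ s p)
    (hq : IsAdmissiblePole δ (-s) q) : p - q ∉ Λ := by
  obtain ⟨n, hn⟩ := hp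
  obtain ⟨k, hk⟩ := hq
  refine notMem_lattice_of_units_mul_im_sub_mem_Ioo hL hδ (-s) (n - k) ?_
  have him : ((-s : ℤˣ) : ℝ) * ((p - q).im - 2 * δ * (n - k : ℤ))
      = -(s * (p.im - 2 * δ * n)) - (-s : ℤˣ) * (q.im - 2 * δ * k) := by
    simp
    ring
  rw [him]
  constructor <;> linarith [hn.1, hn.2, hk.1, hk.2]

/-- Both integrals consist of `℘'(p - x)` times integrals of `ζ₁` over lines and of the same mean
value, so that their difference only depends on the side of the real axis on which `p` lies. -/
lemma exists_hasT_hasTtilde_of_mul_im_mem_Ioo {s : ℤˣ} {p : ℂ}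
    (hp : (s : ℝ) * p.im ∈ Set.Ioo (-δ) 0) (x : ℝ) :
    ∃ Y₁ Y₂ : ℂ,
      HasT L δ hL hδ (fun x' : ℝ => ℘'[𝔓] (x' - p)) x Y₁ ∧
      HasTtilde L δ hL hδ (fun x' : ℝ => ℘'[𝔓] (x' + Complex.I * δ - p)) x Y₂ ∧
      Y₁ - Y₂ = Complex.I * s * ℘'[𝔓] (x - p) := by
  have hneg : (s : ℝ) * (-p).im ∈ Set.Ioo 0 (2 * δ) := by
    rw [Complex.neg_im, mul_neg]
    constructor <;> linarith [hp.1, hp.2]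
  have hshift : (Complex.I * δ - p).im ∈ Set.Ioo 0 (2 * δ) := by
    obtain rfl | rfl := Int.units_eq_one_or s <;> simp at hp ⊢ <;> constructor <;> linarith
  have hI : (Complex.I * (δ : ℂ)).im ∈ Set.Ioo 0 (2 * δ) := by
    constructor <;> simp <;> linarith
  have hline : ∀ y : ℝ, (y : ℂ) + -p ∉ Λ := fun y =>
    notMem_lattice_of_units_mul_im_sub_mem_Ioo hL hδ s 0 (by simpa using hneg)
  have hline_shift : ∀ y : ℝ, (y : ℂ) + (Complex.I * δ - p) ∉ Λ := fun y =>
    notMem_lattice_of_im_mem_Ioo hL hδ (by simpa using hshift)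
  refine ⟨_, _, hasT_derivWeierstrassP hL hδ hline x,
    hasTtilde_derivWeierstrassP hL hδ hline hline_shift x, ?_⟩
  have hodd : ℘'[𝔓] (p - x) = -℘'[𝔓] (x - p) := by
    rw [← PeriodPair.derivWeierstrassP_neg, neg_sub]
  have hpi : (Real.pi : ℂ) ≠ 0 := Complex.ofReal_ne_zero.mpr Real.pi_ne_zero
  rw [lineIntegral_eq hL hδ s hneg, lineIntegral_of_im_mem_Ioo hL hδ hI,
    lineIntegral_of_im_mem_Ioo hL hδ hshift, hodd]
  field_simp
  ring

lemma IsAdmissiblePole.exists_hasT_hasTtilde {s : ℤˣ} {p : ℂ} (h : IsAdmissiblePole δ s p)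
    (x : ℝ) :
    ∃ Y₁ Y₂ : ℂ,
      HasT L δ hL hδ (fun x' : ℝ => ℘'[𝔓] (x' - p)) x Y₁ ∧
      HasTtilde L δ hL hδ (fun x' : ℝ => ℘'[𝔓] (x' + Complex.I * δ - p)) x Y₂ ∧
      Y₁ - Y₂ = Complex.I * s * ℘'[𝔓] (x - p) := by
  obtain ⟨n, hn⟩ := h
  have hperiodic : ∀ z : ℂ, ℘'[𝔓] (z - (p - n • (2 * Complex.I * δ))) = ℘'[𝔓] (z - p) := fun z => by
    rw [sub_sub_eq_add_sub, add_sub_right_comm]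
    exact PeriodPair.derivWeierstrassP_add_coe _ _
      ⟨_, zsmul_mem (two_I_mul_mem_lattice hL hδ) n⟩
  have him : (p - n • (2 * Complex.I * δ)).im = p.im - 2 * δ * n := by simp [mul_comm]
  have hmain := exists_hasT_hasTtilde_of_mul_im_mem_Ioo hL hδ (s := s) (him ▸ hn) x
  simpa only [hperiodic] using hmain

end JumpRelation

section PoleField

variable {P : PeriodPair} (c : ℂ) {ι : Type*} [Fintype ι]

variable (P) in
/-- The field `i ∑_m r_m ζ(x - p_m)` of charges `r_m` at the poles `p_m`, for `ζ` replaced by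
`ζ(z) - c z`. -/
def poleField (r p : ι → ℂ) (x : ℂ) : ℂ := Complex.I * ∑ m, r m * zetaLin P c (x - p m)

lemma poleField_sub_const (r p : ι → ℂ) (l x : ℂ) :
    poleField P c r (fun m => p m - l) x = poleField P c r p (x + l) := by
  simp only [poleField, sub_sub_eq_add_sub, add_sub_right_comm]

lemma poleField_add_period {r p : ι → ℂ} (hr : ∑ m, r m = 0) {l x : ℂ} (hl : l ∈ P.lattice)
    (hx : ∀ m, x - p m ∉ P.lattice) : poleField P c r p (x + l) = poleField P c r p x := by
  obtain ⟨η, hη⟩ := exists_zetaLin_add_period c hl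
  simp only [poleField, add_sub_right_comm, hη _ (hx _), mul_add, Finset.sum_add_distrib,
    ← Finset.sum_mul, hr, zero_mul, add_zero]

lemma hasDerivAt_poleField (r : ι → ℂ) {p : ι → ℂ} {x : ℂ} (hx : ∀ m, x - p m ∉ P.lattice) :
    HasDerivAt (poleField P c r p) (Complex.I * ∑ m, r m * zetaLinDeriv P c (x - p m)) x :=
  (HasDerivAt.fun_sum fun m _ =>
    ((hasDerivAt_zetaLin c (hx m)).comp_sub_const x (p m)).const_mul (r m)).const_mul _

lemma iteratedDeriv_two_poleField (r : ι → ℂ) {p : ι → ℂ}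
    (hp : ∀ m, ∀ x : ℝ, (x : ℂ) - p m ∉ P.lattice) :
    iteratedDeriv 2 (fun x : ℝ => poleField P c r p x)
      = fun x : ℝ => ∑ m, -(Complex.I * r m) * ℘'[P] (x - p m) := by
  have hderiv : deriv (fun x : ℝ => poleField P c r p x)
      = fun x : ℝ => Complex.I * ∑ m, r m * zetaLinDeriv P c (x - p m) :=
    funext fun x => (hasDerivAt_poleField c r fun m => hp m x).comp_ofReal.deriv
  rw [iteratedDeriv_succ, iteratedDeriv_one, hderiv]
  ext x
  have hderiv_two := ((HasDerivAt.fun_sum (u := Finset.univ) fun m _ =>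
    ((hasDerivAt_zetaLinDeriv c (hp m x)).comp_sub_const (x : ℂ) (p m)).const_mul
      (r m)).const_mul Complex.I).comp_ofReal.deriv
  rw [hderiv_two, Finset.mul_sum]
  exact Finset.sum_congr rfl fun m _ => by ring

lemma hasDerivAt_poleField_of_moving (r : ι → ℂ) {p : ι → ℝ → ℂ} {p' : ι → ℂ} {x : ℂ} {t : ℝ}
    (hx : ∀ m, x - p m t ∉ P.lattice) (hp : ∀ m, HasDerivAt (p m) (p' m) t) :
    HasDerivAt (fun s => poleField P c r (fun m => p m s) x)
      (Complex.I * ∑ m, r m * (zetaLinDeriv P c (x - p m t) * -p' m)) t := by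
  refine (HasDerivAt.fun_sum fun m _ => HasDerivAt.const_mul _ ?_).const_mul _
  exact (hasDerivAt_zetaLin c (hx m)).comp t ((hp m).const_sub x)

lemma contDiffOn_poleField (r : ι → ℂ) {p : ι → ℝ → ℂ} {n : WithTop ℕ∞} {I : Set ℝ}
    (hI : IsOpen I) (hx : ∀ t ∈ I, ∀ m, ∀ x : ℝ, (x : ℂ) - p m t ∉ P.lattice)
    (hp : ∀ m, ContDiffOn ℝ n (p m) I) :
    ContDiffOn ℝ n (fun y : ℝ × ℝ => poleField P c r (fun m => p m y.2) y.1)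
      (Set.univ ×ˢ I) := by
  refine contDiffOn_const.mul (ContDiffOn.sum fun m _ => contDiffOn_const.mul ?_)
  rintro ⟨x, t⟩ ⟨-, ht⟩
  have hdiff : DifferentiableOn ℂ (zetaLin P c) (P.lattice : Set ℂ)ᶜ := fun z hz =>
    (hasDerivAt_zetaLin c hz).differentiableAt.differentiableWithinAt
  have hzeta : ContDiffAt ℝ n (zetaLin P c) ((x : ℂ) - p m t) :=
    ((hdiff.analyticAt
      (P.isClosed_lattice.isOpen_compl.mem_nhds (hx t ht m x))).contDiffAt).restrict_scalars ℝ
  have hpole : ContDiffAt ℝ n (fun y : ℝ × ℝ => p m y.2) (x, t) :=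
    ((hp m).contDiffAt (hI.mem_nhds ht)).comp (x, t) contDiffAt_snd
  have hreal : ContDiffAt ℝ n (fun y : ℝ × ℝ => (y.1 : ℂ)) (x, t) :=
    Complex.ofRealCLM.contDiff.contDiffAt.comp (x, t) contDiffAt_fst
  exact (ContDiffAt.comp (x, t) (g := zetaLin P c) (f := fun y : ℝ × ℝ => (y.1 : ℂ) - p m y.2)
    hzeta (hreal.sub hpole)).contDiffWithinAt

lemma deriv_poleField_of_poleVelocity {r : ι → ℂ} (hr : ∑ m, r m = 0) {p : ι → ℝ → ℂ} {t : ℝ}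
    (hp : ∀ m l, m ≠ l → p m t - p l t ∉ P.lattice) {σ : ℂ}
    (hderiv : ∀ m, HasDerivAt (p m) (σ * poleVelocity P c r (fun m => p m t) m) t) {x : ℝ}
    (hx : ∀ m, (x : ℂ) - p m t ∉ P.lattice) :
    deriv (fun s => poleField P c r (fun m => p m s) x) t
      = -σ * (2 * poleField P c r (fun m => p m t) x
          * deriv (fun y : ℝ => poleField P c r (fun m => p m t) y) x
        + ∑ m, r m ^ 2 * ℘'[P] (x - p m t)) := by
  have hidentity := pole_ansatz_identity c hr hp hx
  have hscale : ∑ m, r m * (zetaLinDeriv P c (x - p m t)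
        * -(σ * poleVelocity P c r (fun m => p m t) m))
      = σ * ∑ m, r m * (zetaLinDeriv P c (x - p m t)
        * -poleVelocity P c r (fun m => p m t) m) := by
    rw [Finset.mul_sum]
    exact Finset.sum_congr rfl fun m _ => by ring
  rw [(hasDerivAt_poleField_of_moving c r hx hderiv).deriv,
    (hasDerivAt_poleField c r hx).comp_ofReal.deriv, hscale, poleField]
  linear_combination σ * hidentity

lemma poleVelocity_neg_sub_const (r p : ι → ℂ) (l : ℂ) (j : ι) :
    poleVelocity P c (-r) (fun m => p m - l) j = -poleVelocity P c r p j := by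
  simp only [poleVelocity, sub_sub_sub_cancel_right, Pi.neg_apply, neg_mul, Finset.sum_neg_distrib,
    mul_neg]

end PoleField

section PoleSolution

variable {L δ : ℝ} (hL : 0 < L) (hδ : 0 < δ) (c : ℂ) {ι : Type*} [Fintype ι]

local notation "𝔓" => periods L δ hL hδ
local notation "Λ" => PeriodPair.lattice (periods L δ hL hδ)

lemma intCast_units_sq (s : ℤˣ) : (s : ℂ) ^ 2 = 1 := by
  rcases Int.units_eq_one_or s with h | h <;> simp [h]

lemma exists_hasT_hasTtilde_poleField {s : ι → ℤˣ} {p : ι → ℂ}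
    (h : ∀ m, IsAdmissiblePole δ (s m) (p m)) (x : ℝ) :
    ∃ Y₁ Y₂ : ℂ,
      HasT L δ hL hδ
        (iteratedDeriv 2 fun y : ℝ => poleField 𝔓 c (fun m => (s m : ℂ)) p y) x Y₁ ∧
      HasTtilde L δ hL hδ (iteratedDeriv 2 fun y : ℝ => poleField 𝔓 c (-fun m => (s m : ℂ))
        (fun m => p m - Complex.I * δ) y) x Y₂ ∧
      Y₁ + Y₂ = ∑ m, ℘'[𝔓] (x - p m) := by
  choose Y₁ Y₂ hT hTtilde hjump using fun m => (h m).exists_hasT_hasTtilde hL hδ x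
  refine ⟨∑ m, -(Complex.I * s m) * Y₁ m, ∑ m, Complex.I * s m * Y₂ m, ?_, ?_, ?_⟩
  · rw [iteratedDeriv_two_poleField c _ fun m y => (h m).ofReal_sub_notMem_lattice hL hδ y]
    exact HasT.sum _ hT
  · rw [iteratedDeriv_two_poleField c _ fun m y =>
      (h m).sub_I_mul.ofReal_sub_notMem_lattice hL hδ y]
    simpa only [Pi.neg_apply, mul_neg, neg_neg, sub_sub_eq_add_sub] using HasTtilde.sum _ hTtilde
  · rw [← Finset.sum_add_distrib]
    refine Finset.sum_congr rfl fun m _ => ?_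
    linear_combination -(Complex.I * s m) * hjump m
      - (s m : ℂ) ^ 2 * ℘'[𝔓] (x - p m) * Complex.I_sq + ℘'[𝔓] (x - p m) * intCast_units_sq (s m)

end PoleSolution

section FirstOrderDynamics

variable {L δ : ℝ} {hL : 0 < L} {hδ : 0 < δ} {c : ℂ} {ι : Type*} [Fintype ι]

local notation "𝔓" => periods L δ hL hδ
local notation "Λ" => PeriodPair.lattice (periods L δ hL hδ)

variable (c) in
/-- The pair exchanging the roles of the two fields has charges `-s` and poles `p - iδ`; its own
companion has the poles `p - 2iδ`, which is the original field by periodicity. -/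
lemma exists_hasT_hasTtilde_poleField_swap {s : ι → ℤˣ} {p : ι → ℂ}
    (hs : ∑ m, (s m : ℂ) = 0) (h : ∀ m, IsAdmissiblePole δ (s m) (p m)) (x : ℝ) :
    ∃ Y₁ Y₂ : ℂ,
      HasT L δ hL hδ (iteratedDeriv 2 fun y : ℝ => poleField 𝔓 c (-fun m => (s m : ℂ))
        (fun m => p m - Complex.I * δ) y) x Y₁ ∧
      HasTtilde L δ hL hδ
        (iteratedDeriv 2 fun y : ℝ => poleField 𝔓 c (fun m => (s m : ℂ)) p y) x Y₂ ∧
      Y₁ + Y₂ = ∑ m, ℘'[𝔓] (x - (p m - Complex.I * δ)) := by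
  have hcharge : (fun m => ((-s m : ℤˣ) : ℂ)) = -fun m => (s m : ℂ) := by
    ext m
    simp
  have hperiod : ∀ y : ℝ, poleField 𝔓 c (fun m => (s m : ℂ))
      (fun m => p m - Complex.I * δ - Complex.I * δ) y
        = poleField 𝔓 c (fun m => (s m : ℂ)) p y := by
    intro y
    simp only [sub_sub, ← two_mul, ← mul_assoc]
    rw [poleField_sub_const, poleField_add_period c hs (two_I_mul_mem_lattice hL hδ)
      fun m => (h m).ofReal_sub_notMem_lattice hL hδ y]
  simpa only [hcharge, neg_neg, hperiod] using
    exists_hasT_hasTtilde_poleField hL hδ c (fun m => (h m).sub_I_mul) x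

lemma exists_poleField_equations {s : ι → ℤˣ} (hs : ∑ m, (s m : ℂ) = 0) {p : ι → ℝ → ℂ} {t : ℝ}
    (hne : ∀ m l, m ≠ l → p m t - p l t ∉ Λ) (hadm : ∀ m, IsAdmissiblePole δ (s m) (p m t))
    (hderiv : ∀ m, HasDerivAt (p m)
      (poleVelocity 𝔓 c (fun m => (s m : ℂ)) (fun m => p m t) m) t)
    {u v : ℝ → ℝ → ℂ}
    (hu : u = fun (x : ℝ) t => poleField 𝔓 c (fun m => (s m : ℂ)) (fun m => p m t) x)
    (hv : v = fun (x : ℝ) t =>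
      poleField 𝔓 c (-fun m => (s m : ℂ)) (fun m => p m t - Complex.I * δ) x) (x : ℝ) :
    ∃ Tu Tv Ttu Ttv : ℂ,
      HasT L δ hL hδ (iteratedDeriv 2 fun y => u y t) x Tu ∧
      HasT L δ hL hδ (iteratedDeriv 2 fun y => v y t) x Tv ∧
      HasTtilde L δ hL hδ (iteratedDeriv 2 fun y => u y t) x Ttu ∧
      HasTtilde L δ hL hδ (iteratedDeriv 2 fun y => v y t) x Ttv ∧
      deriv (fun s => u x s) t + 2 * u x t * deriv (fun y => u y t) x + Tu + Ttv = 0 ∧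
      deriv (fun s => v x s) t - 2 * v x t * deriv (fun y => v y t) x - Tv - Ttu = 0 := by
  subst hu hv
  obtain ⟨Tu, Ttv, hTu, hTtv, hu_sum⟩ := exists_hasT_hasTtilde_poleField hL hδ c hadm x
  obtain ⟨Tv, Ttu, hTv, hTtu, hv_sum⟩ := exists_hasT_hasTtilde_poleField_swap c hs hadm x
  have hderiv_sub : ∀ m, HasDerivAt (fun t => p m t - Complex.I * δ) (-1 *
      poleVelocity 𝔓 c (-fun m => (s m : ℂ)) (fun m => p m t - Complex.I * δ) m) t := by
    intro m
    rw [poleVelocity_neg_sub_const, neg_one_mul, neg_neg]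
    exact (hderiv m).sub_const _
  have hu_deriv := deriv_poleField_of_poleVelocity c hs (σ := 1) hne
    (fun m => (hderiv m).congr_deriv (one_mul _).symm)
    fun m => (hadm m).ofReal_sub_notMem_lattice hL hδ x
  have hv_deriv := deriv_poleField_of_poleVelocity c (r := -fun m => (s m : ℂ))
    (p := fun m t => p m t - Complex.I * δ) (by simp [hs]) (by simpa using hne) hderiv_sub
    fun m => (hadm m).sub_I_mul.ofReal_sub_notMem_lattice hL hδ x
  simp only [Pi.neg_apply, neg_sq, intCast_units_sq, one_mul] at hu_deriv hv_deriv
  refine ⟨Tu, Tv, Ttu, Ttv, hTu, hTv, hTtu, hTtv, ?_, ?_⟩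
  · linear_combination hu_deriv + hu_sum
  · linear_combination hv_deriv - hv_sum

lemma isPeriodicSolution_poleField {s : ι → ℤˣ} (hs : ∑ m, (s m : ℂ) = 0) {p : ι → ℝ → ℂ}
    {I : Set ℝ} (hI : IsOpen I) (hp : ∀ m, ContDiffOn ℝ 2 (p m) I)
    (hne : ∀ t ∈ I, ∀ m l, m ≠ l → p m t - p l t ∉ Λ)
    (hadm : ∀ t ∈ I, ∀ m, IsAdmissiblePole δ (s m) (p m t))
    (hdyn : ∀ t ∈ I, ∀ j,
      deriv (p j) t = poleVelocity 𝔓 c (fun m => (s m : ℂ)) (fun m => p m t) j) :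
    IsPeriodicSolution L δ hL hδ I
      (fun x t => poleField 𝔓 c (fun m => (s m : ℂ)) (fun m => p m t) x)
      (fun x t => poleField 𝔓 c (-fun m => (s m : ℂ)) (fun m => p m t - Complex.I * δ) x) := by
  have hs_neg : ∑ m, (-fun m => (s m : ℂ)) m = 0 := by simp [hs]
  have hu : ∀ t ∈ I, ∀ m, ∀ x : ℝ, (x : ℂ) - p m t ∉ Λ := fun t ht m =>
    (hadm t ht m).ofReal_sub_notMem_lattice hL hδ
  have hv : ∀ t ∈ I, ∀ m, ∀ x : ℝ, (x : ℂ) - (p m t - Complex.I * δ) ∉ Λ := fun t ht m =>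
    (hadm t ht m).sub_I_mul.ofReal_sub_notMem_lattice hL hδ
  have hp_sub : ∀ m, ContDiffOn ℝ 2 (fun t => p m t - Complex.I * δ) I := fun m =>
    (hp m).sub contDiffOn_const
  have hcontDiff_u := contDiffOn_poleField c (fun m => (s m : ℂ)) hI hu hp
  have hcontDiff_v := contDiffOn_poleField c (-fun m => (s m : ℂ)) hI hv hp_sub
  have hω₁ : (L : ℂ) ∈ Λ := (periods L δ hL hδ).ω₁_mem_lattice
  have hderiv : ∀ t ∈ I, ∀ m, HasDerivAt (p m)
      (poleVelocity 𝔓 c (fun m => (s m : ℂ)) (fun m => p m t) m) t := by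
    intro t ht m
    rw [← hdyn t ht m]
    exact (((hp m).contDiffAt (hI.mem_nhds ht)).differentiableAt (by simp)).hasDerivAt
  have hequations := fun t ht =>
    exists_poleField_equations (c := c) hs (hne t ht) (hadm t ht) (hderiv t ht) rfl rfl
  refine ⟨hcontDiff_u, hcontDiff_v, fun t ht x => ?_, fun t ht x => ?_, hequations⟩
  · rw [Complex.ofReal_add, poleField_add_period c hs hω₁ fun m => hu t ht m x]
  · rw [Complex.ofReal_add, poleField_add_period c hs_neg hω₁ fun m => hv t ht m x]

lemma IsPeriodicSolution.congr {I : Set ℝ} (hI : IsOpen I) {u v u' v' : ℝ → ℝ → ℂ}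
    (h : IsPeriodicSolution L δ hL hδ I u v) (hu : ∀ t ∈ I, ∀ x, u' x t = u x t)
    (hv : ∀ t ∈ I, ∀ x, v' x t = v x t) : IsPeriodicSolution L δ hL hδ I u' v' where
  contDiffOn_u := h.contDiffOn_u.congr fun y hy => hu y.2 hy.2 y.1
  contDiffOn_v := h.contDiffOn_v.congr fun y hy => hv y.2 hy.2 y.1
  periodic_u t ht x := by rw [hu t ht, hu t ht, h.periodic_u t ht]
  periodic_v t ht x := by rw [hv t ht, hv t ht, h.periodic_v t ht]
  equation t ht x := by
    have hderiv {f g : ℝ → ℝ → ℂ} (hfg : ∀ t ∈ I, ∀ x, f x t = g x t) :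
        deriv (f x) t = deriv (g x) t :=
      Filter.EventuallyEq.deriv_eq <|
        Filter.mem_of_superset (hI.mem_nhds ht) fun s hs => hfg s hs x
    simpa only [hderiv hu, hderiv hv, hu t ht, hv t ht] using h.equation t ht x

end FirstOrderDynamics

section CalogeroMoser

lemma mapsTo_Ioo_of_isPreconnected {X α : Type*} [TopologicalSpace X] [TopologicalSpace α]
    [LinearOrder α] [OrderClosedTopology α] {s : Set X} (hs : IsPreconnected s) {f : X → α}
    (hf : ContinuousOn f s) {a b : α} (hne : ∀ x ∈ s, f x ≠ a ∧ f x ≠ b) {x₀ : X} (hx₀ : x₀ ∈ s)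
    (hfx₀ : f x₀ ∈ Set.Ioo a b) : Set.MapsTo f s (Set.Ioo a b) := by
  refine Set.mapsTo_iff_image_subset.mpr <| (hs.image f hf).subset_left_of_subset_union isOpen_Ioo
    isClosed_Icc.isOpen_compl (disjoint_compl_right.mono_left Set.Ioo_subset_Icc_self) ?_
    ⟨f x₀, Set.mem_image_of_mem f hx₀, hfx₀⟩
  rintro - ⟨x, hx, rfl⟩
  by_cases h : f x ∈ Set.Icc a b
  · exact Or.inl ⟨lt_of_le_of_ne h.1 (hne x hx).1.symm, lt_of_le_of_ne h.2 (hne x hx).2⟩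
  · exact Or.inr h

lemma exists_sub_mem_Ioo_of_forall_lt_abs_sub {δ : ℝ} (hδ : 0 < δ) {y : ℝ}
    (hy : ∀ n : ℤ, δ / 2 < |y - 2 * δ * n|) :
    ∃ n : ℤ, y - 2 * δ * n ∈ Set.Ioo (δ / 2) (3 * δ / 2) := by
  obtain ⟨n, ⟨hn, hn'⟩, -⟩ := existsUnique_sub_zsmul_mem_Ico (mul_pos two_pos hδ) y 0
  rw [zsmul_eq_mul, mul_comm] at hn hn'
  have hlow := hy n
  have hup := hy (n + 1)
  rw [abs_of_nonneg hn] at hlow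
  push_cast at hup
  rw [abs_of_nonpos (by linarith)] at hup
  exact ⟨n, hlow, by linarith⟩

variable {L δ : ℝ} {hL : 0 < L} {hδ : 0 < δ} {I : Set ℝ} {N : ℕ} {z : Fin N → ℝ → ℂ}

lemma IsCalogeroMoser.contDiffOn (hz : IsCalogeroMoser L δ hL hδ I z) (hI : IsOpen I)
    (j : Fin N) : ContDiffOn ℝ 2 (z j) I := by
  have hacceleration : ContinuousOn (deriv (deriv (z j))) I := by
    refine ContinuousOn.congr ?_ fun t ht => (hz.equation t ht j).deriv
    refine continuousOn_const.mul (continuousOn_finsetSum _ fun k hk t ht => ?_)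
    have hne := hz.noncollision t ht j k (Finset.ne_of_mem_erase hk).symm
    exact (ContinuousAt.comp_of_eq (f := fun t => z j t - z k t)
      (hasDerivAt_derivWeierstrassP hne).continuousAt
      ((hz.differentiableAt t ht j).sub (hz.differentiableAt t ht k)).continuousAt
      rfl).continuousWithinAt
  have hvelocity : ContDiffOn ℝ 1 (deriv (z j)) I := by
    rw [← zero_add 1, contDiffOn_succ_iff_deriv_of_isOpen hI]
    exact ⟨fun t ht => (hz.equation t ht j).differentiableAt.differentiableWithinAt, by simp,
      contDiffOn_zero.mpr hacceleration⟩
  rw [← one_add_one_eq_two, contDiffOn_succ_iff_deriv_of_isOpen hI]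
  exact ⟨fun t ht => (hz.differentiableAt t ht j).differentiableWithinAt, by simp, hvelocity⟩

lemma IsCalogeroMoser.exists_im_sub_mem_Ioo (hz : IsCalogeroMoser L δ hL hδ I z)
    (hI : I.OrdConnected) {t₀ : ℝ} (ht₀ : t₀ ∈ I) {j : Fin N}
    (h0 : ∀ n : ℤ, δ / 2 < |(z j t₀).im - 2 * δ * n|) :
    ∃ n : ℤ, ∀ t ∈ I, (z j t).im - 2 * δ * n ∈ Set.Ioo (δ / 2) (3 * δ / 2) := by
  obtain ⟨n, hn⟩ := exists_sub_mem_Ioo_of_forall_lt_abs_sub hδ h0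
  have hcont : ContinuousOn (fun t => (z j t).im - 2 * δ * n) I := fun t ht =>
    (ContinuousAt.sub (Complex.continuous_im.continuousAt.comp
      (hz.differentiableAt t ht j).continuousAt) continuousAt_const).continuousWithinAt
  refine ⟨n, mapsTo_Ioo_of_isPreconnected hI.isPreconnected hcont (fun t ht => ?_) ht₀ hn⟩
  refine ⟨fun h => (hz.im_ne t ht j n).2 ?_, fun h => (hz.im_ne t ht j (n + 1)).1 ?_⟩ <;>
    simp <;> linarith

lemma IsCalogeroMoser.isAdmissiblePole (hz : IsCalogeroMoser L δ hL hδ I z)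
    (hI : I.OrdConnected) {t₀ : ℝ} (ht₀ : t₀ ∈ I)
    (h0 : ∀ j, ∀ n : ℤ, δ / 2 < |(z j t₀).im - 2 * δ * n|) {t : ℝ} (ht : t ∈ I) (j : Fin N) :
    IsAdmissiblePole δ 1 (z j t + Complex.I * δ / 2) ∧
      IsAdmissiblePole δ (-1) (z j t - Complex.I * δ / 2) := by
  obtain ⟨n, hn⟩ := hz.exists_im_sub_mem_Ioo hI ht₀ (h0 j)
  obtain ⟨hlow, hup⟩ := hn t ht
  refine ⟨⟨n + 1, ?_⟩, n, ?_⟩ <;> constructor <;> simp <;> linarith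

end CalogeroMoser

section Soliton

variable {L δ : ℝ} {hL : 0 < L} {hδ : 0 < δ} {I : Set ℝ} {N : ℕ} {z w : Fin N → ℝ → ℂ}

local notation "𝔓" => periods L δ hL hδ
local notation "Λ" => PeriodPair.lattice (periods L δ hL hδ)

variable (N) in
/-- The charges of the poles of `u`: the `z`-poles have charge `1`, the `w`-poles charge `-1`. -/
def charge : Fin N ⊕ Fin N → ℤˣ := Sum.elim (fun _ => 1) fun _ => -1

variable (δ z w) in
/-- The poles of `u`: the `z`-poles are shifted by `iδ/2`, the `w`-poles by `-iδ/2`. -/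
def solitonPole : Fin N ⊕ Fin N → ℝ → ℂ :=
  Sum.elim (fun j t => z j t + Complex.I * δ / 2) fun j t => w j t - Complex.I * δ / 2

lemma sum_charge : ∑ m, (charge N m : ℂ) = 0 := by
  simp [charge]

lemma contDiffOn_solitonPole (hz : IsCalogeroMoser L δ hL hδ I z)
    (hw : IsCalogeroMoser L δ hL hδ I w) (hI : IsOpen I) (m : Fin N ⊕ Fin N) :
    ContDiffOn ℝ 2 (solitonPole δ z w m) I := by
  rcases m with j | j
  · exact (hz.contDiffOn hI j).add contDiffOn_const
  · exact (hw.contDiffOn hI j).sub contDiffOn_const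

lemma differentiableAt_solitonPole (hz : IsCalogeroMoser L δ hL hδ I z)
    (hw : IsCalogeroMoser L δ hL hδ I w) {t : ℝ} (ht : t ∈ I) (m : Fin N ⊕ Fin N) :
    DifferentiableAt ℝ (solitonPole δ z w m) t := by
  rcases m with j | j
  · exact (hz.differentiableAt t ht j).add_const _
  · exact (hw.differentiableAt t ht j).sub_const _

lemma deriv_solitonPole (m : Fin N ⊕ Fin N) :
    deriv (solitonPole δ z w m) = Sum.elim (fun j => deriv (z j)) (fun j => deriv (w j)) m := by
  rcases m with j | j <;> ext t
  · exact deriv_add_const _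
  · exact deriv_sub_const _

lemma solitonPole_sub_notMem_lattice (hz : IsCalogeroMoser L δ hL hδ I z)
    (hw : IsCalogeroMoser L δ hL hδ I w) {t : ℝ} (ht : t ∈ I)
    (hadm : ∀ m, IsAdmissiblePole δ (charge N m) (solitonPole δ z w m t))
    (m l : Fin N ⊕ Fin N) (hml : m ≠ l) :
    solitonPole δ z w m t - solitonPole δ z w l t ∉ Λ := by
  rcases m with j | j <;> rcases l with k | k
  · simpa [solitonPole] using hz.noncollision t ht j k (by simpa using hml)
  · exact (hadm (Sum.inl j)).sub_notMem_lattice hL hδ (hadm (Sum.inr k))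
  · exact (hadm (Sum.inr j)).sub_notMem_lattice hL hδ (by simpa [charge] using hadm (Sum.inl k))
  · simpa [solitonPole] using hw.noncollision t ht j k (by simpa using hml)

lemma hasDerivAt_deriv_solitonPole (hz : IsCalogeroMoser L δ hL hδ I z)
    (hw : IsCalogeroMoser L δ hL hδ I w) {t : ℝ} (ht : t ∈ I) (m : Fin N ⊕ Fin N) :
    HasDerivAt (deriv (solitonPole δ z w m))
      (-2 * ∑ l, ((charge N l : ℂ) ^ 2 + charge N m * charge N l)
        * ℘'[𝔓] (solitonPole δ z w m t - solitonPole δ z w l t)) t := by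
  rw [deriv_solitonPole]
  rcases m with j | j
  · refine (hz.equation t ht j).congr_deriv ?_
    rw [Finset.sum_erase _ (by rw [sub_self, PeriodPair.derivWeierstrassP_zero])]
    simp only [charge, solitonPole, Fintype.sum_sum_type, Sum.elim_inl, Sum.elim_inr, Units.val_one,
      Units.val_neg, Int.cast_neg, Int.cast_one, add_sub_add_right_eq_sub, ← Finset.mul_sum]
    ring
  · refine (hw.equation t ht j).congr_deriv ?_
    rw [Finset.sum_erase _ (by rw [sub_self, PeriodPair.derivWeierstrassP_zero])]
    simp only [charge, solitonPole, Fintype.sum_sum_type, Sum.elim_inl, Sum.elim_inr, Units.val_one,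
      Units.val_neg, Int.cast_neg, Int.cast_one, sub_sub_sub_cancel_right, ← Finset.mul_sum]
    ring

lemma solitonU_eq_poleField (x t : ℝ) :
    solitonU L δ hL hδ z w x t = poleField 𝔓 (zetaSlope 𝔓 (periods L δ hL hδ).ω₂)
      (fun m => (charge N m : ℂ)) (fun m => solitonPole δ z w m t) x := by
  simp [solitonU, poleField, charge, solitonPole, zeta₂_eq_zetaLin, sub_add_eq_sub_sub,
    sub_sub_eq_add_sub, add_sub_right_comm, mul_sub, ← sub_eq_add_neg]

lemma solitonV_eq_poleField {t : ℝ} (hw : ∀ j, IsAdmissiblePole δ 1 (w j t + Complex.I * δ / 2))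
    (x : ℝ) :
    solitonV L δ hL hδ z w x t = poleField 𝔓 (zetaSlope 𝔓 (periods L δ hL hδ).ω₂)
      (-fun m => (charge N m : ℂ)) (fun m => solitonPole δ z w m t - Complex.I * δ) x := by
  have hz_arg : ∀ j, (x : ℂ) - (z j t + Complex.I * δ / 2 - Complex.I * δ)
      = x - z j t + Complex.I * δ / 2 := fun j => by ring
  have hw_arg : ∀ j, zeta₂ 𝔓 (x - (w j t - Complex.I * δ / 2 - Complex.I * δ))
      = zeta₂ 𝔓 (x - w j t - Complex.I * δ / 2) := by
    intro j
    rw [sub_sub (x : ℂ), ← zeta₂_add_ω₂ ((hw j).ofReal_sub_notMem_lattice hL hδ x)]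
    congr 1
    simp only [periods]
    ring
  rw [zeta₂_eq_zetaLin] at hw_arg
  simp [solitonV, poleField, charge, solitonPole, zeta₂_eq_zetaLin, hz_arg, hw_arg, mul_add,
    add_comm]

lemma deriv_solitonPole_eq_poleVelocity {t : ℝ}
    (hadm : ∀ m, IsAdmissiblePole δ (charge N m) (solitonPole δ z w m t))
    (hz : ∀ j, deriv (z j) t =
      2 * Complex.I * ∑ k ∈ Finset.univ.erase j, zeta₂ 𝔓 (z j t - z k t)
        - 2 * Complex.I * ∑ k, zeta₂ 𝔓 (z j t - w k t + Complex.I * δ))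
    (hw : ∀ j, deriv (w j) t =
      -2 * Complex.I * ∑ k ∈ Finset.univ.erase j, zeta₂ 𝔓 (w j t - w k t)
        + 2 * Complex.I * ∑ k, zeta₂ 𝔓 (w j t - z k t + Complex.I * δ))
    (m : Fin N ⊕ Fin N) :
    deriv (solitonPole δ z w m) t = poleVelocity 𝔓 (zetaSlope 𝔓 (periods L δ hL hδ).ω₂)
      (fun l => (charge N l : ℂ)) (fun l => solitonPole δ z w l t) m := by
  have hzw_arg : ∀ j k, z j t + Complex.I * δ / 2 - (w k t - Complex.I * δ / 2)
      = z j t - w k t + Complex.I * δ := fun j k => by ring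
  have hwz_arg : ∀ j k, zeta₂ 𝔓 (w j t - Complex.I * δ / 2 - (z k t + Complex.I * δ / 2))
      = zeta₂ 𝔓 (w j t - z k t + Complex.I * δ) := by
    intro j k
    have hne : w j t - Complex.I * δ / 2 - (z k t + Complex.I * δ / 2) ∉ Λ :=
      (hadm (Sum.inr j)).sub_notMem_lattice hL hδ (by simpa [charge] using! hadm (Sum.inl k))
    rw [← zeta₂_add_ω₂ hne]
    congr 1
    simp only [periods]
    ring
  rw [deriv_solitonPole, poleVelocity, ← zeta₂_eq_zetaLin]
  rcases m with j | j
  · rw [Sum.elim_inl, hz, Finset.sum_erase _ (by rw [sub_self, zeta₂_eq_zetaLin, zetaLin_zero])]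
    simp [charge, solitonPole, hzw_arg, mul_sub, ← sub_eq_add_neg]
  · rw [Sum.elim_inr, hw, Finset.sum_erase _ (by rw [sub_self, zeta₂_eq_zetaLin, zetaLin_zero])]
    simp [charge, solitonPole, hwz_arg, mul_add, add_comm]

end Soliton

end NcILW

end

open NcILW in
theorem mainTheorem3 (L δ : ℝ) (hL : 0 < L) (hδ : 0 < δ) (N : ℕ) (a b : Fin N → ℂ)
    (ha : ∀ j, ∀ n : ℤ, δ / 2 < |(a j).im - 2 * δ * n|)
    (hb : ∀ j, ∀ n : ℤ, δ / 2 < |(b j).im - 2 * δ * n|)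
    (I : Set ℝ) (hI : IsOpen I) (hI' : I.OrdConnected) (h0 : (0 : ℝ) ∈ I)
    (z w : Fin N → ℝ → ℂ)
    (hz : NcILW.IsCalogeroMoser L δ hL hδ I z)
    (hw : NcILW.IsCalogeroMoser L δ hL hδ I w)
    (hz0 : ∀ j, z j 0 = a j)
    (hw0 : ∀ j, w j 0 = b j)
    (hz1 : ∀ j, deriv (z j) 0 =
      2 * Complex.I * ∑ k ∈ Finset.univ.erase j,
          NcILW.zeta₂ (NcILW.periods L δ hL hδ) (a j - a k)
        - 2 * Complex.I * ∑ k,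
          NcILW.zeta₂ (NcILW.periods L δ hL hδ) (a j - b k + Complex.I * (δ : ℂ)))
    (hw1 : ∀ j, deriv (w j) 0 =
      -2 * Complex.I * ∑ k ∈ Finset.univ.erase j,
          NcILW.zeta₂ (NcILW.periods L δ hL hδ) (b j - b k)
        + 2 * Complex.I * ∑ k,
          NcILW.zeta₂ (NcILW.periods L δ hL hδ) (b j - a k + Complex.I * (δ : ℂ))) :
    NcILW.IsPeriodicSolution L δ hL hδ I
      (NcILW.solitonU L δ hL hδ z w) (NcILW.solitonV L δ hL hδ z w) := by
  obtain rfl : a = fun j => z j 0 := funext fun j => (hz0 j).symm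
  obtain rfl : b = fun j => w j 0 := funext fun j => (hw0 j).symm
  have hw_strip := fun t (ht : t ∈ I) => hw.isAdmissiblePole hI' h0 hb ht
  have hadm : ∀ t ∈ I, ∀ m, IsAdmissiblePole δ (charge N m) (solitonPole δ z w m t) := by
    rintro t ht (j | j)
    · exact (hz.isAdmissiblePole hI' h0 ha ht j).1
    · exact (hw_strip t ht j).2
  have hne := fun t ht => solitonPole_sub_notMem_lattice hz hw ht (hadm t ht)
  have hvelocity := fun t (ht : t ∈ I) => deriv_eq_poleVelocity _ sum_charge hI' hne
    (fun t ht => differentiableAt_solitonPole hz hw ht)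
    (fun t ht => hasDerivAt_deriv_solitonPole hz hw ht) h0
    (deriv_solitonPole_eq_poleVelocity (hadm 0 h0) hz1 hw1) ht
  have hsolution := isPeriodicSolution_poleField sum_charge hI (contDiffOn_solitonPole hz hw hI)
    hne hadm hvelocity
  exact hsolution.congr hI (fun t _ x => solitonU_eq_poleField x t)
    fun t ht x => solitonV_eq_poleField (fun j => (hw_strip t ht j).1) x
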